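/- Let $p=(p_i^j)$ be an $N\times N$ matrix with non-negative entries. Assume that $p$ is fully indecomposable (every non-empty proper set $R$ of rows has positive entries in more than $|R|$ columns) and has more than $2N$ positive entries; both hold in particular if $N\ge 3$ and all $p_i^j>0$. Assume that there is a unique permutation $\sigma_*$ (the maximum-likelihood, ML, perfect matching) maximizing $\prod_i p_i^{\sigma(i)}$, and write $\sigma_*$ also for its $0/1$ matrix, $\sigma_{*i}^{\ j}=1$ if $j=\sigma_*(i)$ and $0$ otherwise. For $T>0$ let $P(T)=((p_i^j)^{1/T})$. For a doubly stochastic matrix $\beta$ the Bethe free energy is $$\mathcal F_T(\beta)=T\sum_{i,j}\Bigl(\beta_i^j\ln\frac{\beta_i^j}{(p_i^j)^{1/T}}-(1-\beta_i^j)\ln(1-\beta_i^j)\Bigr),$$ with $0\ln 0=0$ and with the value $+\infty$ if $\beta_i^j>0=p_i^j$ for some $(i,j)$. A BP solution at temperature $T$ is a doubly stochastic $\beta$ such that, for some real $\mu_i,\mu^j$, $$\beta_i^j(1-\beta_i^j)=(p_i^j)^{1/T}e^{\mu_i+\mu^j}\quad\text{for all } i,j.$$ Then there is a temperature $T_c\in(0,\infty)$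 with the following properties. 1. $\det\bigl(P(T_c)_i^j-2\sigma_{*i}^{\ j}P(T_c)_i^j\bigr)_{i,j}=0$. 2. There are $\varepsilon>0$ and a continuous family $T\mapsto\beta(T)$ on $[T_c,T_c+\varepsilon)$ of matrices with $\beta(T_c)=\sigma_*$ such that for every $T\in(T_c,T_c+\varepsilon)$ the matrix $\beta(T)$ is a BP solution at temperature $T$, satisfies $0<\beta(T)_i^j<1$ for all $(i,j)$ with $p_i^j>0$, is a local minimum of $\mathcal F_T$ on the set of doubly stochastic matrices, and satisfies $\mathcal F_T(\beta(T))<\mathcal F_T(\sigma_*)$. 3. For $0<T<T_c$ there is no BP solution at temperature $T$ with a non-integer entry. -/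

import Mathlib

/-- The matrix `P = ((p i j)^(1/T))` at temperature `T`. -/
noncomputable def thermalMatrix {N : ℕ} (p : Matrix (Fin N) (Fin N) ℝ) (T : ℝ) :
    Matrix (Fin N) (Fin N) ℝ :=
  Matrix.of fun i j => (p i j) ^ (1 / T)

/-- `σ` is the unique perfect matching of maximal weight (the maximum-likelihood matching). -/
def IsMLMatching {N : ℕ} (p : Matrix (Fin N) (Fin N) ℝ) (σ : Equiv.Perm (Fin N)) : Prop :=
  ∀ τ : Equiv.Perm (Fin N), τ ≠ σ → ∏ i, p i (τ i) < ∏ i, p i (σ i)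

/-- Full indecomposability of a non-negative matrix: every non-empty proper set `R` of rows has
positive entries in more than `|R|` columns. -/
def FullyIndecomposable {N : ℕ} (p : Matrix (Fin N) (Fin N) ℝ) : Prop :=
  ∀ R : Finset (Fin N), R.Nonempty → R ≠ Finset.univ →
    R.card < {j : Fin N | ∃ i ∈ R, 0 < p i j}.ncard

/-- The Bethe free energy
`T * ∑ (β ln (β / p^(1/T)) - (1 - β) ln (1 - β))`, with `0 ln 0 = 0`; it is `+∞` when `β` puts
positive mass on an entry with `p i j = 0`. -/
noncomputable def betheFreeEnergy {N : ℕ} (p : Matrix (Fin N) (Fin N) ℝ) (T : ℝ)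
    (β : Matrix (Fin N) (Fin N) ℝ) : EReal :=
  open Classical in
  if ∃ i j, p i j = 0 ∧ β i j ≠ 0 then ⊤
  else ((T * ∑ i, ∑ j, (β i j * Real.log (β i j / thermalMatrix p T i j)
    - (1 - β i j) * Real.log (1 - β i j)) : ℝ) : EReal)

/-- Solutions of the belief-propagation equations: `β` is doubly stochastic and
`β (1 - β) = p^(1/T) exp (μ_i + μ^j)` for some real Lagrange multipliers. -/
def IsBPSolution {N : ℕ} (p : Matrix (Fin N) (Fin N) ℝ) (T : ℝ)
    (β : Matrix (Fin N) (Fin N) ℝ) : Prop :=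
  β ∈ doublyStochastic ℝ (Fin N) ∧
    ∃ μ ν : Fin N → ℝ, ∀ i j,
      β i j * (1 - β i j) = thermalMatrix p T i j * Real.exp (μ i + ν j)

/-- The matrix `P i j - 2 σ i j P i j`, where `σ i j = 1` if `j = σ i` and `0` otherwise. -/
noncomputable def criticalMatrix {N : ℕ} (p : Matrix (Fin N) (Fin N) ℝ)
    (σ : Equiv.Perm (Fin N)) (T : ℝ) : Matrix (Fin N) (Fin N) ℝ :=
  Matrix.of fun i j => thermalMatrix p T i j - 2 * σ.permMatrix ℝ i j * thermalMatrix p T i j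

/-!
On the face `bethePolytope p` of the Birkhoff polytope the free energy is the linear energy with
costs `-ln p` minus `T` times the Bethe entropy. For a probability vector `b` with entries below `1`
and a vector `v` of sum zero, `∑ j, v j ^ 2 * (1 / b j - 1 / (1 - b j))` is a weighted sum of the
squares `(v k / b k + v j / (1 - b j)) ^ 2`. Hence the entropy is concave, and strictly so once some
row has three positive entries, because full indecomposability carries `v = 0` from one row to all
others. Interior critical points are exactly the BP solutions. The derivative of the free energy
diverges logarithmically at the boundary, so a minimizer is either interior or a permutation, which
can then only be `σ`.

The matching `σ` is minimal at small `T`, because the entropy is at most linear in the distance to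
`σ`, and not at large `T`, because the entropy is positive in the interior. Since `σ` has entropy
zero, lowering `T` only helps `σ`, so `Tc` is the supremum of the temperatures at which it is
minimal. Minimizers are unique and hence depend continuously on `T`. For a BP solution `β` the
matrix `P` with each matched entry multiplied by `1 - r i`, where
`r i = (∑ j, β i j * (1 - β i j)) / (β i (σ i) * (1 - β i (σ i)))`, annihilates the vector
`exp ν` of the column multipliers `ν`, and `r i → 2` as `β → σ`.
-/

/-! ### The second variation on a simplex -/

section SimplexForm

variable {ι : Type*} [Fintype ι] {b v : ι → ℝ}

theorem sum_erase_mul_sq_eq [DecidableEq ι] (hb : b ∈ stdSimplex ℝ ι) (hv0 : ∀ j, b j = 0 → v j = 0)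
    (hv : ∑ j, v j = 0) {j : ι} (hj : b j < 1) :
    ∑ k ∈ Finset.univ.erase j, b k * (v k / b k + v j / (1 - b j)) ^ 2 =
      ∑ k, v k ^ 2 / b k - v j ^ 2 / b j - v j ^ 2 / (1 - b j) := by
  have hj' : 1 - b j ≠ 0 := (sub_pos.2 hj).ne'
  have hterm : ∀ k, b k * (v k / b k + v j / (1 - b j)) ^ 2 =
      v k ^ 2 / b k + 2 * (v j / (1 - b j)) * v k + (v j / (1 - b j)) ^ 2 * b k := by
    intro k
    rcases eq_or_ne (b k) 0 with hk | hk
    · simp [hk, hv0 k hk]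
    · field_simp
      ring
  simp_rw [hterm]
  rw [Finset.sum_add_distrib, Finset.sum_add_distrib, ← Finset.mul_sum, ← Finset.mul_sum,
    Finset.sum_erase_eq_sub (Finset.mem_univ j), Finset.sum_erase_eq_sub (Finset.mem_univ j),
    Finset.sum_erase_eq_sub (Finset.mem_univ j), hv, hb.2]
  field_simp
  ring

theorem sum_sq_mul_one_div_sub_one_div_eq [DecidableEq ι] (hb : b ∈ stdSimplex ℝ ι)
    (hb1 : ∀ j, b j < 1) (hv0 : ∀ j, b j = 0 → v j = 0) (hv : ∑ j, v j = 0) :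
    ∑ j, v j ^ 2 * (1 / b j - 1 / (1 - b j)) =
      ∑ j, b j * ∑ k ∈ Finset.univ.erase j, b k * (v k / b k + v j / (1 - b j)) ^ 2 := by
  have hterm : ∀ j, b j * (∑ k, v k ^ 2 / b k - v j ^ 2 / b j - v j ^ 2 / (1 - b j)) =
      b j * ∑ k, v k ^ 2 / b k - v j ^ 2 / (1 - b j) := by
    intro j
    have hj' : 1 - b j ≠ 0 := (sub_pos.2 (hb1 j)).ne'
    rcases eq_or_ne (b j) 0 with hj | hj
    · simp [hj, hv0 j hj]
    · field_simp
      ring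
  simp_rw [sum_erase_mul_sq_eq hb hv0 hv (hb1 _), hterm]
  rw [Finset.sum_sub_distrib, ← Finset.sum_mul, hb.2, one_mul, ← Finset.sum_sub_distrib]
  exact Finset.sum_congr rfl fun j _ => by ring

theorem sum_sq_mul_one_div_sub_one_div_nonneg (hb : b ∈ stdSimplex ℝ ι) (hb1 : ∀ j, b j < 1)
    (hv0 : ∀ j, b j = 0 → v j = 0) (hv : ∑ j, v j = 0) :
    0 ≤ ∑ j, v j ^ 2 * (1 / b j - 1 / (1 - b j)) := by
  classical
  rw [sum_sq_mul_one_div_sub_one_div_eq hb hb1 hv0 hv]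
  exact Finset.sum_nonneg fun j _ => mul_nonneg (hb.1 j) <| Finset.sum_nonneg fun k _ =>
    mul_nonneg (hb.1 k) (sq_nonneg _)

theorem div_eq_neg_div_of_sum_sq_mul_eq_zero (hb : b ∈ stdSimplex ℝ ι) (hb1 : ∀ j, b j < 1)
    (hv0 : ∀ j, b j = 0 → v j = 0) (hv : ∑ j, v j = 0)
    (hQ : ∑ j, v j ^ 2 * (1 / b j - 1 / (1 - b j)) = 0) {j k : ι} (hj : b j ≠ 0) (hk : b k ≠ 0)
    (hkj : k ≠ j) : v k / b k = -(v j / (1 - b j)) := by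
  classical
  have hinner : ∀ j k, 0 ≤ b k * (v k / b k + v j / (1 - b j)) ^ 2 :=
    fun j k => mul_nonneg (hb.1 k) (sq_nonneg _)
  rw [sum_sq_mul_one_div_sub_one_div_eq hb hb1 hv0 hv, Finset.sum_eq_zero_iff_of_nonneg
    fun j _ => mul_nonneg (hb.1 j) (Finset.sum_nonneg fun k _ => hinner j k)] at hQ
  have hQj := (mul_eq_zero.1 (hQ j (Finset.mem_univ j))).resolve_left hj
  rw [Finset.sum_eq_zero_iff_of_nonneg fun k _ => hinner j k] at hQj
  have hQjk := (mul_eq_zero.1 (hQj k (by simp [hkj]))).resolve_left hk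
  exact eq_neg_of_add_eq_zero_left (pow_eq_zero_iff two_ne_zero |>.1 hQjk)

theorem eq_zero_of_sum_sq_mul_eq_zero_of_apply_eq_zero (hb : b ∈ stdSimplex ℝ ι)
    (hb1 : ∀ j, b j < 1) (hv0 : ∀ j, b j = 0 → v j = 0) (hv : ∑ j, v j = 0)
    (hQ : ∑ j, v j ^ 2 * (1 / b j - 1 / (1 - b j)) = 0) {k : ι} (hk : b k ≠ 0) (hvk : v k = 0) :
    v = 0 := by
  ext j
  by_cases hj : b j = 0
  · exact hv0 j hj
  rcases eq_or_ne k j with rfl | hkj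
  · exact hvk
  have h := div_eq_neg_div_of_sum_sq_mul_eq_zero hb hb1 hv0 hv hQ hj hk hkj
  rw [hvk, zero_div, eq_comm, neg_eq_zero, div_eq_zero_iff] at h
  exact h.resolve_right (sub_pos.2 (hb1 j)).ne'

theorem eq_zero_of_sum_sq_mul_eq_zero_of_two_lt_ncard (hb : b ∈ stdSimplex ℝ ι)
    (hb1 : ∀ j, b j < 1) (hv0 : ∀ j, b j = 0 → v j = 0) (hv : ∑ j, v j = 0)
    (hQ : ∑ j, v j ^ 2 * (1 / b j - 1 / (1 - b j)) = 0) (hcard : 2 < {j | b j ≠ 0}.ncard) :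
    v = 0 := by
  obtain ⟨x, hx, y, hy, z, hz, hxy, hxz, hyz⟩ := (Set.two_lt_ncard).1 hcard
  have hpair := fun {j k : ι} =>
    div_eq_neg_div_of_sum_sq_mul_eq_zero (j := j) (k := k) hb hb1 hv0 hv hQ
  have hx' : v x / b x = -(v x / (1 - b x)) := by
    rw [← hpair hx hz hxz.symm, hpair hy hz hyz.symm, hpair hy hx hxy]
  refine eq_zero_of_sum_sq_mul_eq_zero_of_apply_eq_zero hb hb1 hv0 hv hQ hx ?_
  have hx1 : 1 - b x ≠ 0 := (sub_pos.2 (hb1 x)).ne'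
  rw [Set.mem_ofPred_eq] at hx
  field_simp at hx'
  linarith

end SimplexForm

/-! ### The Bethe entropy -/

/-- The contribution `-x ln x + (1 - x) ln (1 - x)` of one matrix entry to the Bethe entropy. -/
noncomputable def betheEntropyTerm (x : ℝ) : ℝ := Real.negMulLog x - Real.negMulLog (1 - x)

@[simp]
theorem betheEntropyTerm_zero : betheEntropyTerm 0 = 0 := by simp [betheEntropyTerm]

@[simp]
theorem betheEntropyTerm_one : betheEntropyTerm 1 = 0 := by simp [betheEntropyTerm]

theorem continuous_betheEntropyTerm : Continuous betheEntropyTerm := by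
  unfold betheEntropyTerm
  fun_prop

theorem hasDerivAt_betheEntropyTerm {x : ℝ} (h0 : 0 < x) (h1 : x < 1) :
    HasDerivAt betheEntropyTerm (-(Real.log (x * (1 - x)) + 2)) x := by
  have hx : 1 - x ≠ 0 := (sub_pos.2 h1).ne'
  have hright := (Real.hasDerivAt_negMulLog hx).comp x ((hasDerivAt_id x).const_sub 1)
  refine ((Real.hasDerivAt_negMulLog h0.ne').sub hright).congr_deriv ?_
  rw [Real.log_mul h0.ne' hx]
  ring

theorem hasDerivAt_log_mul_one_sub {x : ℝ} (h0 : 0 < x) (h1 : x < 1) :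
    HasDerivAt (fun x => Real.log (x * (1 - x))) (1 / x - 1 / (1 - x)) x := by
  have hx : 1 - x ≠ 0 := (sub_pos.2 h1).ne'
  have hpoly : HasDerivAt (fun x : ℝ => x * (1 - x)) (1 - 2 * x) x :=
    ((hasDerivAt_id' x).fun_mul ((hasDerivAt_id' x).const_sub 1)).congr_deriv (by ring)
  refine (hpoly.log (mul_ne_zero h0.ne' hx)).congr_deriv ?_
  field_simp
  ring

theorem negMulLog_le_sub_sub_mul_log {x y : ℝ} (hx : 0 ≤ x) (hy : 0 ≤ y) (hxy : y = 0 → x = 0) :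
    Real.negMulLog x ≤ y - x - x * Real.log y := by
  rcases hx.eq_or_lt with rfl | hx
  · simpa using hy
  have hy : 0 < y := hy.lt_of_ne' fun h => hx.ne' (hxy h)
  have hmul := mul_le_mul_of_nonneg_left (Real.log_le_sub_one_of_pos (div_pos hy hx)) hx.le
  rw [Real.log_div hy.ne' hx.ne', mul_sub, mul_sub, mul_div_cancel₀ _ hx.ne'] at hmul
  rw [Real.negMulLog]
  linarith

theorem sum_betheEntropyTerm_le {ι : Type*} [Fintype ι] {b : ι → ℝ} (hb : b ∈ stdSimplex ℝ ι)
    (k : ι) : ∑ j, betheEntropyTerm (b j) ≤ Fintype.card ι * (1 - b k) := by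
  classical
  have herase : ∑ j ∈ Finset.univ.erase k, b j = 1 - b k := by
    rw [Finset.sum_erase_eq_sub (Finset.mem_univ k), hb.2]
  have hd : 0 ≤ 1 - b k := sub_nonneg.2 (mem_Icc_of_mem_stdSimplex hb k).2
  have hterm : ∀ j ∈ Finset.univ.erase k,
      betheEntropyTerm (b j) ≤ 1 - b k - b j - b j * Real.log (1 - b k) := by
    intro j hj
    have hjd : b j ≤ 1 - b k := herase ▸ Finset.single_le_sum (fun i _ => hb.1 i) hj
    have hcompl : 0 ≤ Real.negMulLog (1 - b j) := Real.negMulLog_nonneg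
      (sub_nonneg.2 (mem_Icc_of_mem_stdSimplex hb j).2) (by linarith [hb.1 j])
    exact (sub_le_self _ hcompl).trans <| negMulLog_le_sub_sub_mul_log (hb.1 j) hd fun h =>
      (hjd.trans_eq h).antisymm (hb.1 j)
  calc ∑ j, betheEntropyTerm (b j)
      = betheEntropyTerm (b k) + ∑ j ∈ Finset.univ.erase k, betheEntropyTerm (b j) :=
        (Finset.add_sum_erase _ _ (Finset.mem_univ k)).symm
    _ ≤ betheEntropyTerm (b k) +
        ∑ j ∈ Finset.univ.erase k, (1 - b k - b j - b j * Real.log (1 - b k)) := by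
        gcongr with j hj
        exact hterm j hj
    _ = Real.negMulLog (b k) + (Fintype.card ι - 2) * (1 - b k) := by
        rw [Finset.sum_sub_distrib, Finset.sum_sub_distrib, ← Finset.sum_mul, herase,
          Finset.sum_const, nsmul_eq_mul, Finset.cast_card_erase_of_mem (Finset.mem_univ k),
          Finset.card_univ, betheEntropyTerm, Real.negMulLog, Real.negMulLog]
        ring
    _ ≤ Fintype.card ι * (1 - b k) := by
        linarith [Real.negMulLog_le_one_sub_self (hb.1 k)]

theorem hasDerivAt_add_smul_apply {m n : Type*} (β v : Matrix m n ℝ) (i : m) (j : n) (t : ℝ) :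
    HasDerivAt (fun s : ℝ => (β + s • v) i j) (v i j) t := by
  simpa using ((hasDerivAt_id t).mul_const (v i j)).const_add (β i j)

section Entropy

variable {m n : Type*} [Fintype m] [Fintype n]

/-- The Bethe entropy of a matrix; the Bethe free energy is energy minus `T` times this. -/
noncomputable def betheEntropy (β : Matrix m n ℝ) : ℝ := ∑ i, ∑ j, betheEntropyTerm (β i j)

/-- The linear functional `β ↦ ∑ c i j * β i j`; for a cost matrix `c` it is the energy. -/
noncomputable def frobeniusPairing (c : Matrix m n ℝ) : Matrix m n ℝ →ₗ[ℝ] ℝ :=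
  ∑ i, ∑ j, c i j • Matrix.entryLinearMap ℝ ℝ i j

/-- The gradient of the Bethe entropy, to be paired with directions by `frobeniusPairing`. It is
meaningful at the entries of `β` in `(0, 1)` only. -/
noncomputable def betheEntropyGradient (β : Matrix m n ℝ) : Matrix m n ℝ :=
  Matrix.of fun i j => -(Real.log (β i j * (1 - β i j)) + 2)

/-- Minus the second derivative of the Bethe entropy at `β` in the direction `v`. -/
noncomputable def betheSecondVariation (β v : Matrix m n ℝ) : ℝ :=
  ∑ i, ∑ j, v i j ^ 2 * (1 / β i j - 1 / (1 - β i j))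

theorem frobeniusPairing_apply (c β : Matrix m n ℝ) :
    frobeniusPairing c β = ∑ i, ∑ j, c i j * β i j := by
  simp [frobeniusPairing, LinearMap.sum_apply]

theorem continuous_betheEntropy : Continuous (betheEntropy : Matrix m n ℝ → ℝ) :=
  continuous_finsetSum _ fun i _ => continuous_finsetSum _ fun j _ =>
    continuous_betheEntropyTerm.comp (continuous_id.matrix_elem i j)

theorem continuous_frobeniusPairing (c : Matrix m n ℝ) : Continuous (frobeniusPairing c) := by
  simp_rw [funext (frobeniusPairing_apply c)]
  exact continuous_finsetSum _ fun i _ => continuous_finsetSum _ fun j _ =>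
    continuous_const.mul (continuous_id.matrix_elem i j)

theorem hasDerivAt_betheEntropy_line {β v : Matrix m n ℝ} {t : ℝ}
    (h : ∀ i j, v i j ≠ 0 → 0 < (β + t • v) i j ∧ (β + t • v) i j < 1) :
    HasDerivAt (fun s : ℝ => betheEntropy (β + s • v))
      (frobeniusPairing (betheEntropyGradient (β + t • v)) v) t := by
  rw [frobeniusPairing_apply]
  refine HasDerivAt.fun_sum fun i _ => HasDerivAt.fun_sum fun j _ => ?_
  by_cases hv : v i j = 0
  · simpa [hv] using hasDerivAt_const t _
  · exact (hasDerivAt_betheEntropyTerm (h i j hv).1 (h i j hv).2).comp t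
      (hasDerivAt_add_smul_apply β v i j t)

theorem hasDerivAt_frobeniusPairing_betheEntropyGradient_line {β v : Matrix m n ℝ} {t : ℝ}
    (h : ∀ i j, v i j ≠ 0 → 0 < (β + t • v) i j ∧ (β + t • v) i j < 1) :
    HasDerivAt (fun s : ℝ => frobeniusPairing (betheEntropyGradient (β + s • v)) v)
      (-betheSecondVariation (β + t • v) v) t := by
  simp_rw [frobeniusPairing_apply, betheSecondVariation, ← Finset.sum_neg_distrib]
  refine HasDerivAt.fun_sum fun i _ => HasDerivAt.fun_sum fun j _ => ?_
  by_cases hv : v i j = 0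
  · simpa [hv] using hasDerivAt_const t _
  · have hlog := (hasDerivAt_log_mul_one_sub (h i j hv).1 (h i j hv).2).comp t
      (hasDerivAt_add_smul_apply β v i j t)
    exact ((hlog.add_const 2).neg.mul_const (v i j)).congr_deriv (by ring)

theorem betheSecondVariation_transpose (β v : Matrix m n ℝ) :
    betheSecondVariation β.transpose v.transpose = betheSecondVariation β v :=
  Finset.sum_comm

end Entropy

/-! ### The polytope of supported doubly stochastic matrices -/

section Polytope

theorem permMatrix_apply {n : Type*} [DecidableEq n] (τ : Equiv.Perm n) (i j : n) :
    τ.permMatrix ℝ i j = if j = τ i then 1 else 0 := by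
  simp [Equiv.Perm.permMatrix, PEquiv.toMatrix_apply, eq_comm]

variable {n : Type*} [Fintype n] {p β γ v : Matrix n n ℝ}

/-- `v` is a direction in the linear span of the differences of points of `bethePolytope p`. -/
structure IsTangent (p v : Matrix n n ℝ) : Prop where
  sum_row : ∀ i, ∑ j, v i j = 0
  sum_col : ∀ j, ∑ i, v i j = 0
  pos_of_ne_zero : ∀ i j, v i j ≠ 0 → 0 < p i j

theorem IsTangent.transpose (hv : IsTangent p v) : IsTangent p.transpose v.transpose :=
  ⟨hv.sum_col, hv.sum_row, fun i j => hv.pos_of_ne_zero j i⟩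

variable [DecidableEq n]

/-- The face of the Birkhoff polytope on which the Bethe free energy is finite: the doubly
stochastic matrices supported where `p` is positive. -/
def bethePolytope (p : Matrix n n ℝ) : Set (Matrix n n ℝ) :=
  {β | β ∈ doublyStochastic ℝ n ∧ ∀ i j, β i j ≠ 0 → 0 < p i j}

/-- The points of `bethePolytope p` all of whose entries on the support of `p` are fractional. -/
def betheInterior (p : Matrix n n ℝ) : Set (Matrix n n ℝ) :=
  {β | β ∈ bethePolytope p ∧ ∀ i j, 0 < p i j → 0 < β i j ∧ β i j < 1}

theorem frobeniusPairing_permMatrix (c : Matrix n n ℝ) (τ : Equiv.Perm n) :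
    frobeniusPairing c (τ.permMatrix ℝ) = ∑ i, c i (τ i) := by
  simp [frobeniusPairing_apply]

theorem betheEntropy_permMatrix (τ : Equiv.Perm n) : betheEntropy (τ.permMatrix ℝ) = 0 := by
  simp [betheEntropy, apply_ite betheEntropyTerm]

theorem row_mem_stdSimplex (hβ : β ∈ doublyStochastic ℝ n) (i : n) : β i ∈ stdSimplex ℝ n :=
  ⟨fun _ => nonneg_of_mem_doublyStochastic hβ, sum_row_of_mem_doublyStochastic hβ i⟩

theorem transpose_mem_bethePolytope (hβ : β ∈ bethePolytope p) :
    β.transpose ∈ bethePolytope p.transpose :=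
  ⟨transpose_mem_doublyStochastic_iff.2 hβ.1, fun i j => hβ.2 j i⟩

theorem transpose_mem_betheInterior (hβ : β ∈ betheInterior p) :
    β.transpose ∈ betheInterior p.transpose :=
  ⟨transpose_mem_bethePolytope hβ.1, fun i j => hβ.2 j i⟩

theorem isTangent_sub (hβ : β ∈ bethePolytope p) (hγ : γ ∈ bethePolytope p) :
    IsTangent p (γ - β) where
  sum_row i := by
    simp [sum_row_of_mem_doublyStochastic hβ.1, sum_row_of_mem_doublyStochastic hγ.1]
  sum_col j := by
    simp [sum_col_of_mem_doublyStochastic hβ.1, sum_col_of_mem_doublyStochastic hγ.1]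
  pos_of_ne_zero i j hv := by
    by_cases hγij : γ i j = 0
    · exact hβ.2 i j fun hβij => hv (by simp [hβij, hγij])
    · exact hγ.2 i j hγij

theorem lt_one_of_mem_betheInterior (hβ : β ∈ betheInterior p) (i j : n) : β i j < 1 := by
  by_cases hij : β i j = 0
  · exact hij ▸ one_pos
  · exact (hβ.2 i j (hβ.1.2 i j hij)).2

theorem apply_eq_zero_of_mem_betheInterior (hβ : β ∈ betheInterior p) (hv : IsTangent p v) (i j : n)
    (hij : β i j = 0) : v i j = 0 :=
  by_contra fun h => (hβ.2 i j (hv.pos_of_ne_zero i j h)).1.ne' hij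

theorem permMatrix_mem_bethePolytope {τ : Equiv.Perm n} (hτ : ∀ i, 0 < p i (τ i)) :
    τ.permMatrix ℝ ∈ bethePolytope p := by
  refine ⟨permMatrix_mem_doublyStochastic, fun i j hij => ?_⟩
  rw [permMatrix_apply, ite_ne_right_iff] at hij
  exact hij.1 ▸ hτ i

theorem pos_of_permMatrix_mem_bethePolytope {τ : Equiv.Perm n}
    (hτ : τ.permMatrix ℝ ∈ bethePolytope p) (i : n) : 0 < p i (τ i) :=
  hτ.2 i (τ i) (by simp)

theorem convex_bethePolytope (p : Matrix n n ℝ) : Convex ℝ (bethePolytope p) := by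
  intro x hx y hy a b ha hb hab
  refine ⟨convex_doublyStochastic hx.1 hy.1 ha hb hab, fun i j hij => ?_⟩
  by_contra hp
  have hx0 : x i j = 0 := by_contra fun h => hp (hx.2 i j h)
  have hy0 : y i j = 0 := by_contra fun h => hp (hy.2 i j h)
  exact hij (by simp [hx0, hy0])

theorem bethePolytope_eq_convexHull (p : Matrix n n ℝ) :
    bethePolytope p =
    convexHull ℝ ((fun τ : Equiv.Perm n => τ.permMatrix ℝ) '' {τ | ∀ i, 0 < p i (τ i)}) := by
  refine Set.Subset.antisymm (fun β hβ => ?_) (convexHull_min ?_ (convex_bethePolytope p))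
  · obtain ⟨w, hw0, hw1, rfl⟩ := exists_eq_sum_perm_of_mem_doublyStochastic hβ.1
    rw [← finsum_eq_sum_of_fintype]
    refine (convex_convexHull ℝ _).finsum_mem hw0 (by rwa [finsum_eq_sum_of_fintype]) fun τ hτ =>
      subset_convexHull ℝ _ ⟨τ, fun i => hβ.2 i (τ i) (ne_of_gt ?_), rfl⟩
    have hle := Finset.single_le_sum
      (fun ρ _ => mul_nonneg (hw0 ρ) (nonneg_of_mem_doublyStochastic (i := i) (j := τ i)
        (permMatrix_mem_doublyStochastic (σ := ρ)))) (Finset.mem_univ τ)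
    rw [permMatrix_apply, if_pos rfl, mul_one] at hle
    simpa [Matrix.sum_apply] using ((hw0 τ).lt_of_ne' hτ).trans_le hle
  · rintro _ ⟨τ, hτ, rfl⟩
    exact permMatrix_mem_bethePolytope hτ

theorem isCompact_bethePolytope (p : Matrix n n ℝ) : IsCompact (bethePolytope p) := by
  rw [bethePolytope_eq_convexHull]
  exact (Set.toFinite _).isCompact_convexHull (𝕜 := ℝ)

theorem permMatrix_notMem_betheInterior [Nonempty n] (τ : Equiv.Perm n) :
    τ.permMatrix ℝ ∉ betheInterior p := by
  intro h
  obtain ⟨i⟩ := ‹Nonempty n›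
  exact (lt_one_of_mem_betheInterior h i (τ i)).ne (by simp)

theorem add_smul_sub_mem_betheInterior (hβ : β ∈ betheInterior p) (hγ : γ ∈ bethePolytope p) {t : ℝ}
    (ht : t ∈ Set.Ico (0 : ℝ) 1) : β + t • (γ - β) ∈ betheInterior p := by
  refine ⟨(convex_bethePolytope p).add_smul_sub_mem hβ.1 hγ ⟨ht.1, ht.2.le⟩, fun i j hij => ?_⟩
  have hγ0 : 0 ≤ γ i j := nonneg_of_mem_doublyStochastic hγ.1
  have hγ1 : γ i j ≤ 1 := le_one_of_mem_doublyStochastic hγ.1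
  obtain ⟨hβ0, hβ1⟩ := hβ.2 i j hij
  simp only [Matrix.add_apply, Matrix.smul_apply, Matrix.sub_apply, smul_eq_mul]
  constructor <;> nlinarith [ht.1, ht.2]

theorem sum_sq_row_nonneg (hβ : β ∈ betheInterior p) (hv : IsTangent p v) (i : n) :
    0 ≤ ∑ j, v i j ^ 2 * (1 / β i j - 1 / (1 - β i j)) :=
  sum_sq_mul_one_div_sub_one_div_nonneg (row_mem_stdSimplex hβ.1.1 i)
    (lt_one_of_mem_betheInterior hβ i) (apply_eq_zero_of_mem_betheInterior hβ hv i) (hv.sum_row i)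

theorem betheSecondVariation_nonneg (hβ : β ∈ betheInterior p) (hv : IsTangent p v) :
    0 ≤ betheSecondVariation β v :=
  Finset.sum_nonneg fun i _ => sum_sq_row_nonneg hβ hv i

theorem sum_sq_row_eq_zero (hβ : β ∈ betheInterior p) (hv : IsTangent p v)
    (hQ : betheSecondVariation β v = 0) (i : n) :
    ∑ j, v i j ^ 2 * (1 / β i j - 1 / (1 - β i j)) = 0 :=
  (Finset.sum_eq_zero_iff_of_nonneg fun i _ => sum_sq_row_nonneg hβ hv i).1 hQ i (Finset.mem_univ i)

theorem row_eq_zero_of_apply_eq_zero (hβ : β ∈ betheInterior p) (hv : IsTangent p v)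
    (hQ : betheSecondVariation β v = 0) {i j : n} (hij : 0 < p i j) (hvij : v i j = 0) :
    v i = 0 :=
  eq_zero_of_sum_sq_mul_eq_zero_of_apply_eq_zero (row_mem_stdSimplex hβ.1.1 i)
    (lt_one_of_mem_betheInterior hβ i) (apply_eq_zero_of_mem_betheInterior hβ hv i) (hv.sum_row i)
    (sum_sq_row_eq_zero hβ hv hQ i) (hβ.2 i j hij).1.ne' hvij

theorem row_eq_zero_of_two_lt_ncard (hβ : β ∈ betheInterior p) (hv : IsTangent p v)
    (hQ : betheSecondVariation β v = 0) {i : n} (hi : 2 < {j | 0 < p i j}.ncard) :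
    v i = 0 := by
  have hsupp : {j | β i j ≠ 0} = {j | 0 < p i j} :=
    Set.ext fun j => ⟨hβ.1.2 i j, fun hij => (hβ.2 i j hij).1.ne'⟩
  exact eq_zero_of_sum_sq_mul_eq_zero_of_two_lt_ncard (row_mem_stdSimplex hβ.1.1 i)
    (lt_one_of_mem_betheInterior hβ i) (apply_eq_zero_of_mem_betheInterior hβ hv i) (hv.sum_row i)
    (sum_sq_row_eq_zero hβ hv hQ i) (hsupp ▸ hi)

theorem row_eq_zero_of_row_eq_zero (hβ : β ∈ betheInterior p) (hv : IsTangent p v)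
    (hQ : betheSecondVariation β v = 0) {i i' j : n} (hij : 0 < p i j) (hij' : 0 < p i' j)
    (hi : v i = 0) : v i' = 0 := by
  have hcol : v.transpose j = 0 := row_eq_zero_of_apply_eq_zero (i := j) (j := i)
    (transpose_mem_betheInterior hβ) hv.transpose ((betheSecondVariation_transpose β v).trans hQ)
    hij (congr_fun hi j)
  exact row_eq_zero_of_apply_eq_zero hβ hv hQ hij' (congr_fun hcol i')

end Polytope

/-! ### Full indecomposability -/

theorem exists_lt_ncard_row {m n : Type*} [Fintype m] [Finite n] {k : ℕ} {s : Set (m × n)}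
    (hs : Fintype.card m * k < s.ncard) : ∃ i, k < {j | (i, j) ∈ s}.ncard := by
  classical
  rw [Set.ncard_eq_toFinset_card s] at hs
  obtain ⟨i, -, hi⟩ := Finset.exists_lt_card_fiber_of_mul_lt_card_of_maps_to
    (f := Prod.fst) (t := Finset.univ) (fun _ _ => Finset.mem_univ _) hs
  refine ⟨i, hi.trans_le ?_⟩
  rw [← Set.ncard_coe_finset]
  refine Set.ncard_le_ncard_of_injOn Prod.snd ?_ ?_
  · rintro ⟨i', j⟩ hx
    simp only [Finset.coe_filter, Set.Finite.mem_toFinset, Set.mem_ofPred_eq] at hx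
    exact hx.2 ▸ hx.1
  · rintro ⟨i', j⟩ hx ⟨i'', j'⟩ hx' (rfl : j = j')
    simp only [Finset.coe_filter, Set.mem_ofPred_eq] at hx hx'
    rw [hx.2, hx'.2]

namespace FullyIndecomposable

variable {N : ℕ} {p : Matrix (Fin N) (Fin N) ℝ}

theorem forall_of_exists (hind : FullyIndecomposable p) {P : Fin N → Prop}
    (hP : ∀ i i' j, 0 < p i j → 0 < p i' j → P i → P i') {i : Fin N} (hi : P i) (i' : Fin N) :
    P i' := by
  classical
  let R : Finset (Fin N) := {i | P i}
  by_contra hi'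
  have hiR : i ∈ R := by simpa [R] using hi
  have hiR' : i' ∈ Rᶜ := by simpa [R] using hi'
  have hcard := hind R ⟨i, hiR⟩ fun h => (Finset.mem_compl.1 hiR') (h ▸ Finset.mem_univ i')
  have hcardc := hind Rᶜ ⟨i', hiR'⟩ fun h => Finset.mem_compl.1 (h ▸ Finset.mem_univ i) hiR
  have hdisj : Disjoint {j | ∃ i ∈ R, 0 < p i j} {j | ∃ i ∈ Rᶜ, 0 < p i j} := by
    rw [Set.disjoint_left]
    rintro j ⟨a, ha, haj⟩ ⟨b, hb, hbj⟩
    simp only [R, Finset.mem_compl, Finset.mem_filter, Finset.mem_univ, true_and] at ha hb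
    exact hb (hP a b j haj hbj ha)
  have hunion := Set.ncard_le_card ({j | ∃ i ∈ R, 0 < p i j} ∪ {j | ∃ i ∈ Rᶜ, 0 < p i j})
  rw [Set.ncard_union_eq hdisj, Nat.card_eq_fintype_card] at hunion
  have := Finset.card_add_card_compl R
  omega

theorem card_le_ncard_sdiff (hind : FullyIndecomposable p) {A : Finset (Fin N)} {i₀ : Fin N}
    (hi₀ : i₀ ∉ A) (j₀ : Fin N) : A.card ≤ ({j | ∃ i ∈ A, 0 < p i j} \ {j₀}).ncard := by
  rcases A.eq_empty_or_nonempty with rfl | hA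
  · simp
  · have hcard := hind A hA fun h => hi₀ (h ▸ Finset.mem_univ i₀)
    have := Set.pred_ncard_le_ncard_sdiff_singleton {j | ∃ i ∈ A, 0 < p i j} j₀
    omega

theorem exists_perm (hind : FullyIndecomposable p) {i₀ j₀ : Fin N} (h₀ : 0 < p i₀ j₀) :
    ∃ τ : Equiv.Perm (Fin N), τ i₀ = j₀ ∧ ∀ i, 0 < p i (τ i) := by
  classical
  let r : Fin N → Fin N → Prop := fun i j => 0 < p i j ∧ (i = i₀ ↔ j = j₀)
  have hall : ∀ A : Finset (Fin N), A.card ≤ {j | ∃ i ∈ A, r i j}.ncard := by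
    intro A
    have hA := hind.card_le_ncard_sdiff (A.notMem_erase i₀) j₀
    by_cases hi₀ : i₀ ∈ A
    · rw [← Finset.card_erase_add_one hi₀]
      refine (Nat.succ_le_succ hA).trans ?_
      rw [Nat.succ_eq_add_one, ← Set.ncard_insert_of_notMem (a := j₀) (by simp)]
      refine Set.ncard_le_ncard (Set.insert_subset ⟨i₀, hi₀, h₀, by simp⟩ ?_)
      rintro j ⟨⟨i, hi, hij⟩, hj⟩
      exact ⟨i, Finset.mem_of_mem_erase hi, hij, iff_of_false (Finset.ne_of_mem_erase hi) hj⟩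
    · rw [Finset.erase_eq_of_notMem hi₀] at hA
      refine hA.trans (Set.ncard_le_ncard ?_)
      rintro j ⟨⟨i, hi, hij⟩, hj⟩
      exact ⟨i, hi, hij, iff_of_false (fun h => hi₀ (h ▸ hi)) hj⟩
  obtain ⟨f, hf, hr⟩ := (Fintype.all_card_le_filter_rel_iff_exists_injective r).1 fun A => by
    convert hall A
    rw [Set.ncard_eq_toFinset_card', Set.toFinset_ofPred]
    congr!
  exact ⟨Equiv.ofBijective f (Finite.injective_iff_bijective.1 hf), (hr i₀).2.1 rfl,
    fun i => (hr i).1⟩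

section Nontrivial

variable [Nontrivial (Fin N)]

theorem exists_ne_pos (hind : FullyIndecomposable p) (i j : Fin N) : ∃ k ≠ j, 0 < p i k := by
  have hcard := hind {i} (Finset.singleton_nonempty i) (Finset.singleton_ne_univ i)
  obtain ⟨k, hk, hkj⟩ := Set.exists_ne_of_one_lt_ncard hcard j
  exact ⟨k, hkj, by simpa using hk⟩

theorem mem_betheInterior_of_pos (hind : FullyIndecomposable p) {β : Matrix (Fin N) (Fin N) ℝ}
    (hβ : β ∈ bethePolytope p) (hpos : ∀ i j, 0 < p i j → 0 < β i j) : β ∈ betheInterior p := by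
  refine ⟨hβ, fun i j hij => ⟨hpos i j hij, ?_⟩⟩
  obtain ⟨k, hkj, hik⟩ := hind.exists_ne_pos i j
  have hsum := Finset.add_le_sum (fun j _ => (row_mem_stdSimplex hβ.1 i).1 j) (Finset.mem_univ j)
    (Finset.mem_univ k) hkj.symm
  rw [(row_mem_stdSimplex hβ.1 i).2] at hsum
  linarith [hpos i k hik]

theorem betheInterior_nonempty (hind : FullyIndecomposable p) : (betheInterior p).Nonempty := by
  classical
  let S : Finset (Equiv.Perm (Fin N)) := {τ | ∀ i, 0 < p i (τ i)}
  have hS : S.Nonempty := by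
    obtain ⟨i⟩ : Nonempty (Fin N) := inferInstance
    obtain ⟨j, -, hij⟩ := hind.exists_ne_pos i i
    obtain ⟨τ, -, hτ⟩ := hind.exists_perm hij
    exact ⟨τ, by simpa [S] using hτ⟩
  have hw : 0 < (S.card : ℝ)⁻¹ := inv_pos.2 (Nat.cast_pos.2 hS.card_pos)
  refine ⟨∑ τ ∈ S, (S.card : ℝ)⁻¹ • τ.permMatrix ℝ, hind.mem_betheInterior_of_pos ?_ ?_⟩
  · refine (convex_bethePolytope p).sum_mem (fun _ _ => hw.le) ?_ fun τ hτ =>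
      permMatrix_mem_bethePolytope (by simpa [S] using hτ)
    rw [Finset.sum_const, nsmul_eq_mul, mul_inv_cancel₀ (inv_pos.1 hw).ne']
  · intro i j hij
    obtain ⟨τ, rfl, hτ⟩ := hind.exists_perm hij
    rw [Matrix.sum_apply]
    refine Finset.sum_pos' (fun ρ _ => ?_) ⟨τ, by simpa [S] using hτ, by simpa using hw⟩
    exact mul_nonneg hw.le (nonneg_of_mem_doublyStochastic permMatrix_mem_doublyStochastic)

end Nontrivial

end FullyIndecomposable

/-! ### Strict concavity of the entropy -/

section Concavity

variable {N : ℕ} {p β γ v : Matrix (Fin N) (Fin N) ℝ}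

theorem FullyIndecomposable.betheSecondVariation_pos (hind : FullyIndecomposable p)
    (hrow : ∃ i, 2 < {j | 0 < p i j}.ncard) (hβ : β ∈ betheInterior p) (hv : IsTangent p v)
    (hne : v ≠ 0) : 0 < betheSecondVariation β v := by
  refine (betheSecondVariation_nonneg hβ hv).lt_of_ne' fun hQ => hne ?_
  obtain ⟨i, hi⟩ := hrow
  exact funext <| hind.forall_of_exists (P := fun i => v i = 0)
    (fun _ _ _ hij hij' h => row_eq_zero_of_row_eq_zero hβ hv hQ hij hij' h)
    (row_eq_zero_of_two_lt_ncard hβ hv hQ hi)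

theorem FullyIndecomposable.strictConcaveOn_betheEntropy_line (hind : FullyIndecomposable p)
    (hrow : ∃ i, 2 < {j | 0 < p i j}.ncard) (hβ : β ∈ betheInterior p) (hγ : γ ∈ bethePolytope p)
    (hne : γ ≠ β) :
    StrictConcaveOn ℝ (Set.Icc 0 1) fun t : ℝ => betheEntropy (β + t • (γ - β)) := by
  have hv := isTangent_sub hβ.1 hγ
  have hmem : ∀ t ∈ Set.Ioo (0 : ℝ) 1, β + t • (γ - β) ∈ betheInterior p := fun t ht =>
    add_smul_sub_mem_betheInterior hβ hγ (Set.Ioo_subset_Ico_self ht)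
  have hfrac : ∀ t ∈ Set.Ioo (0 : ℝ) 1, ∀ i j, (γ - β) i j ≠ 0 →
      0 < (β + t • (γ - β)) i j ∧ (β + t • (γ - β)) i j < 1 :=
    fun t ht i j hij => (hmem t ht).2 i j (hv.pos_of_ne_zero i j hij)
  have hcont : Continuous fun t : ℝ => betheEntropy (β + t • (γ - β)) :=
    continuous_betheEntropy.comp (by fun_prop)
  refine StrictAntiOn.strictConcaveOn_of_deriv (convex_Icc 0 1) hcont.continuousOn ?_
  rw [interior_Icc]
  have hslope : StrictAntiOn (fun t : ℝ =>
      frobeniusPairing (betheEntropyGradient (β + t • (γ - β))) (γ - β)) (Set.Ioo 0 1) := by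
    refine strictAntiOn_of_deriv_neg (convex_Ioo 0 1) (fun t ht =>
      (hasDerivAt_frobeniusPairing_betheEntropyGradient_line
        (hfrac t ht)).continuousAt.continuousWithinAt) fun t ht => ?_
    rw [interior_Ioo] at ht
    rw [(hasDerivAt_frobeniusPairing_betheEntropyGradient_line (hfrac t ht)).deriv, neg_lt_zero]
    exact hind.betheSecondVariation_pos hrow (hmem t ht) hv (sub_ne_zero.2 hne)
  exact hslope.congr fun t ht => (hasDerivAt_betheEntropy_line (hfrac t ht)).deriv.symm

theorem FullyIndecomposable.betheEntropy_lt_add_frobeniusPairing (hind : FullyIndecomposable p)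
    (hrow : ∃ i, 2 < {j | 0 < p i j}.ncard) (hβ : β ∈ betheInterior p) (hγ : γ ∈ bethePolytope p)
    (hne : γ ≠ β) :
    betheEntropy γ < betheEntropy β + frobeniusPairing (betheEntropyGradient β) (γ - β) := by
  have hderiv := hasDerivAt_betheEntropy_line (β := β) (v := γ - β) (t := 0) fun i j hij => by
    simpa using hβ.2 i j ((isTangent_sub hβ.1 hγ).pos_of_ne_zero i j hij)
  have hslope := (hind.strictConcaveOn_betheEntropy_line hrow hβ hγ hne).slope_lt_of_hasDerivAt
    (by simp) (by simp) one_pos hderiv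
  simp only [slope_def_field, one_smul, zero_smul, add_zero, add_sub_cancel, sub_zero,
    div_one] at hslope
  linarith

theorem FullyIndecomposable.betheEntropy_pos (hind : FullyIndecomposable p)
    (hrow : ∃ i, 2 < {j | 0 < p i j}.ncard) (hβ : β ∈ betheInterior p) : 0 < betheEntropy β := by
  have : Nonempty (Fin N) := hrow.nonempty
  have hconvex : Convex ℝ {γ | frobeniusPairing (betheEntropyGradient β) β - betheEntropy β <
      frobeniusPairing (betheEntropyGradient β) γ} :=
    convex_halfSpace_gt (frobeniusPairing (betheEntropyGradient β)).isLinear _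
  have hsub : bethePolytope p ⊆ {γ | frobeniusPairing (betheEntropyGradient β) β -
      betheEntropy β < frobeniusPairing (betheEntropyGradient β) γ} := by
    rw [bethePolytope_eq_convexHull]
    refine convexHull_min ?_ hconvex
    rintro _ ⟨τ, hτ, rfl⟩
    have hlt := hind.betheEntropy_lt_add_frobeniusPairing hrow hβ
      (permMatrix_mem_bethePolytope hτ) fun h => permMatrix_notMem_betheInterior τ (h ▸ hβ)
    rw [betheEntropy_permMatrix, map_sub] at hlt
    rw [Set.mem_ofPred_eq]
    linarith
  simpa using hsub hβ.1

end Concavity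

/-! ### Minimizers of the Bethe objective -/

section Objective

variable {n : Type*} [Fintype n] {c p β v : Matrix n n ℝ} {T t : ℝ}

/-- The Bethe free energy on `bethePolytope p` when `c i j = -log (p i j)`. It makes sense for every
cost matrix `c` and is real-valued on all matrices. -/
noncomputable def betheObjective (c : Matrix n n ℝ) (T : ℝ) (β : Matrix n n ℝ) : ℝ :=
  frobeniusPairing c β - T * betheEntropy β

/-- The gradient of `betheObjective c T`, to be paired with directions by `frobeniusPairing`. -/
noncomputable def betheGradient (c : Matrix n n ℝ) (T : ℝ) (β : Matrix n n ℝ) : Matrix n n ℝ :=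
  c - T • betheEntropyGradient β

theorem frobeniusPairing_betheGradient (c : Matrix n n ℝ) (T : ℝ) (β v : Matrix n n ℝ) :
    frobeniusPairing (betheGradient c T β) v =
      frobeniusPairing c v - T * frobeniusPairing (betheEntropyGradient β) v := by
  simp only [frobeniusPairing_apply, betheGradient, Matrix.sub_apply, Matrix.smul_apply,
    smul_eq_mul, sub_mul, Finset.sum_sub_distrib, Finset.mul_sum, mul_assoc]

theorem continuous_betheObjective (c : Matrix n n ℝ) :
    Continuous fun x : ℝ × Matrix n n ℝ => betheObjective c x.1 x.2 :=
  ((continuous_frobeniusPairing c).comp continuous_snd).sub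
    (continuous_fst.mul (continuous_betheEntropy.comp continuous_snd))

theorem hasDerivAt_betheObjective_line (c : Matrix n n ℝ) (T : ℝ)
    (h : ∀ i j, v i j ≠ 0 → 0 < (β + t • v) i j ∧ (β + t • v) i j < 1) :
    HasDerivAt (fun s : ℝ => betheObjective c T (β + s • v))
      (frobeniusPairing (betheGradient c T (β + t • v)) v) t := by
  rw [frobeniusPairing_betheGradient]
  refine HasDerivAt.sub ?_ ((hasDerivAt_betheEntropy_line h).const_mul T)
  simpa using ((hasDerivAt_id t).mul_const (frobeniusPairing c v)).const_add (frobeniusPairing c β)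

theorem exists_multipliers {g : Matrix n n ℝ} (hg : ∀ v, IsTangent p v → frobeniusPairing g v = 0) :
    ∃ μ ν : n → ℝ, ∀ i j, 0 < p i j → g i j = μ i + ν j := by
  classical
  let mask : Matrix n n ℝ := Matrix.of fun i j => if 0 < p i j then 1 else 0
  let L : n ⊕ n → Matrix n n ℝ →ₗ[ℝ] ℝ :=
    Sum.elim (fun i => frobeniusPairing (Matrix.of fun k j => if k = i then mask k j else 0))
      fun j => frobeniusPairing (Matrix.of fun i k => if k = j then mask i k else 0)
  have hker : ⨅ k, (L k).ker ≤ (frobeniusPairing (Matrix.of fun i j => g i j * mask i j)).ker := by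
    intro v hv
    rw [Submodule.mem_iInf] at hv
    have htangent : IsTangent p (Matrix.of fun i j => mask i j * v i j) :=
      { sum_row i := by simpa [L, frobeniusPairing_apply] using hv (Sum.inl i)
        sum_col j := by simpa [L, frobeniusPairing_apply] using hv (Sum.inr j)
        pos_of_ne_zero i j hij := by
          by_contra hp
          simp [mask, hp] at hij }
    simpa only [frobeniusPairing_apply, Matrix.of_apply, LinearMap.mem_ker, mul_assoc]
      using hg _ htangent
  obtain ⟨a, ha⟩ := (Submodule.mem_span_range_iff_exists_fun ℝ).1 (mem_span_of_iInf_ker_le_ker hker)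
  have hsingle : ∀ (d : Matrix n n ℝ) i j, frobeniusPairing d (Matrix.single i j 1) = d i j := by
    intro d i j
    simp [frobeniusPairing_apply, Matrix.single_apply, ite_and]
  refine ⟨fun i => a (Sum.inl i), fun j => a (Sum.inr j), fun i j hij => ?_⟩
  have hij' := LinearMap.congr_fun ha (Matrix.single i j 1)
  simpa [L, mask, hsingle, hij, Fintype.sum_sum_type] using hij'.symm

variable [DecidableEq n]

theorem betheObjective_permMatrix (c : Matrix n n ℝ) (T : ℝ) (τ : Equiv.Perm n) :
    betheObjective c T (τ.permMatrix ℝ) = frobeniusPairing c (τ.permMatrix ℝ) := by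
  simp [betheObjective, betheEntropy_permMatrix]

theorem eventually_add_smul_mem_bethePolytope (hβ : β ∈ betheInterior p) (hv : IsTangent p v) :
    ∀ᶠ t in nhds (0 : ℝ), β + t • v ∈ bethePolytope p := by
  have hentry : ∀ᶠ t in nhds (0 : ℝ), ∀ i j, 0 ≤ (β + t • v) i j := by
    refine Filter.eventually_all.2 fun i => Filter.eventually_all.2 fun j => ?_
    by_cases hij : 0 < p i j
    · have hlim := (hasDerivAt_add_smul_apply β v i j 0).continuousAt.eventually
        (lt_mem_nhds (a := 0) (by simpa using (hβ.2 i j hij).1))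
      exact hlim.mono fun t => le_of_lt
    · have hvij : v i j = 0 := by_contra fun h => hij (hv.pos_of_ne_zero i j h)
      simp [hvij, nonneg_of_mem_doublyStochastic hβ.1.1]
  filter_upwards [hentry] with t ht
  refine ⟨mem_doublyStochastic_iff_sum.2 ⟨ht, fun i => ?_, fun j => ?_⟩, fun i j hij => ?_⟩
  · simp [Finset.sum_add_distrib, ← Finset.mul_sum, hv.sum_row,
      sum_row_of_mem_doublyStochastic hβ.1.1]
  · simp [Finset.sum_add_distrib, ← Finset.mul_sum, hv.sum_col,
      sum_col_of_mem_doublyStochastic hβ.1.1]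
  · by_contra hp
    have hβij : β i j = 0 := by_contra fun h => hp (hβ.1.2 i j h)
    have hvij : v i j = 0 := by_contra fun h => hp (hv.pos_of_ne_zero i j h)
    exact hij (by simp [hβij, hvij])

theorem frobeniusPairing_betheGradient_eq_zero (hβ : β ∈ betheInterior p)
    (hmin : IsMinOn (betheObjective c T) (bethePolytope p) β) (hv : IsTangent p v) :
    frobeniusPairing (betheGradient c T β) v = 0 := by
  have hderiv := hasDerivAt_betheObjective_line (β := β) (v := v) (t := 0) c T fun i j hij => by
    simpa using hβ.2 i j (hv.pos_of_ne_zero i j hij)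
  have hloc : IsLocalMin (fun t : ℝ => betheObjective c T (β + t • v)) 0 :=
    (eventually_add_smul_mem_bethePolytope hβ hv).mono fun t ht => by
      simpa using isMinOn_iff.1 hmin _ ht
  simpa using hloc.hasDerivAt_eq_zero hderiv

end Objective

/-! ### The boundary of the polytope -/

section Boundary

/-- The rate at which the derivative of `betheEntropyTerm` along `t ↦ b + t * v` diverges: it is
`-endpointSlope b v * log t` up to a bounded error as `t → 0`. -/
noncomputable def endpointSlope (b v : ℝ) : ℝ := if b = 0 ∨ b = 1 then v else 0

theorem exists_tendsto_mul_log_sub_endpointSlope (b v : ℝ) :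
    ∃ L, Filter.Tendsto (fun t => v * Real.log ((b + t * v) * (1 - (b + t * v))) -
      endpointSlope b v * Real.log t) (nhdsWithin 0 (Set.Ioi 0)) (nhds L) := by
  have hlog : ∀ f : ℝ → ℝ, Continuous f → f 0 ≠ 0 → Filter.Tendsto
      (fun t => v * Real.log (f t)) (nhdsWithin 0 (Set.Ioi 0)) (nhds (v * Real.log (f 0))) :=
    fun f hf hf0 => ((hf.continuousAt.log hf0).const_mul v).tendsto.mono_left nhdsWithin_le_nhds
  have hfactor : ∀ f : ℝ → ℝ, Continuous f → f 0 ≠ 0 → endpointSlope b v = v →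
      (∀ t, (b + t * v) * (1 - (b + t * v)) = t * f t) →
      ∃ L, Filter.Tendsto (fun t => v * Real.log ((b + t * v) * (1 - (b + t * v))) -
        endpointSlope b v * Real.log t) (nhdsWithin 0 (Set.Ioi 0)) (nhds L) := by
    intro f hf hf0 hslope heq
    refine ⟨_, (hlog f hf hf0).congr' ?_⟩
    filter_upwards [self_mem_nhdsWithin, nhdsWithin_le_nhds (hf.continuousAt.eventually_ne hf0)]
      with t ht hft
    rw [heq, Real.log_mul (ne_of_gt ht) hft, hslope]
    ring
  rcases eq_or_ne v 0 with rfl | hv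
  · exact ⟨0, by simp [endpointSlope]⟩
  by_cases hb0 : b = 0
  · exact hfactor (fun t => v * (1 - t * v)) (by fun_prop) (by simpa) (by simp [endpointSlope, hb0])
      fun t => by rw [hb0]; ring
  by_cases hb1 : b = 1
  · exact hfactor (fun t => -v * (1 + t * v)) (by fun_prop) (by simpa)
      (by simp [endpointSlope, hb1]) fun t => by rw [hb1]; ring
  · refine ⟨_, (hlog (fun t => (b + t * v) * (1 - (b + t * v))) (by fun_prop) ?_).congr fun t => ?_⟩
    · simp [hb0, sub_eq_zero, Ne.symm hb1]
    · simp [endpointSlope, hb0, hb1]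

theorem exists_tendsto_frobeniusPairing_betheGradient_line {n : Type*} [Fintype n]
    (c : Matrix n n ℝ) (T : ℝ) (β v : Matrix n n ℝ) :
    ∃ L, Filter.Tendsto (fun t : ℝ => frobeniusPairing (betheGradient c T (β + t • v)) v -
      T * (∑ i, ∑ j, endpointSlope (β i j) (v i j)) * Real.log t)
      (nhdsWithin 0 (Set.Ioi 0)) (nhds L) := by
  choose L hL using fun i j => exists_tendsto_mul_log_sub_endpointSlope (β i j) (v i j)
  have hsum := tendsto_finsetSum Finset.univ fun i _ => tendsto_finsetSum Finset.univ fun j _ =>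
    ((hL i j).const_mul T).const_add (c i j * v i j + T * 2 * v i j)
  refine ⟨_, hsum.congr fun t => ?_⟩
  simp only [frobeniusPairing_apply, betheGradient, betheEntropyGradient, Matrix.of_apply,
    Matrix.sub_apply, Matrix.smul_apply, Matrix.add_apply, smul_eq_mul, Finset.mul_sum,
    Finset.sum_mul, ← Finset.sum_sub_distrib]
  exact Finset.sum_congr rfl fun i _ => Finset.sum_congr rfl fun j _ => by ring

theorem eq_zero_of_mem_stdSimplex_of_apply_eq_one {ι : Type*} [Fintype ι] {b : ι → ℝ}
    (hb : b ∈ stdSimplex ℝ ι) {j k : ι} (hk : b k = 1) (hjk : j ≠ k) : b j = 0 := by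
  have hsum := Finset.add_le_sum (fun j _ => hb.1 j) (Finset.mem_univ j) (Finset.mem_univ k) hjk
  rw [hb.2, hk] at hsum
  exact le_antisymm (by linarith) (hb.1 j)

section Simplex

variable {ι : Type*} [Fintype ι] {b g : ι → ℝ}

theorem endpointSlope_sub_nonneg (hg : g ∈ stdSimplex ℝ ι)
    {j : ι} (hj : b j ≠ 1) : 0 ≤ endpointSlope (b j) (g j - b j) := by
  by_cases h0 : b j = 0
  · simpa [endpointSlope, h0] using hg.1 j
  · simp [endpointSlope, h0, hj]

theorem sum_endpointSlope_nonneg (hb : b ∈ stdSimplex ℝ ι) (hg : g ∈ stdSimplex ℝ ι) :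
    0 ≤ ∑ j, endpointSlope (b j) (g j - b j) := by
  by_cases hone : ∃ k, b k = 1
  · obtain ⟨k, hk⟩ := hone
    have hslope : ∀ j, endpointSlope (b j) (g j - b j) = g j - b j := fun j =>
      if_pos <| (eq_or_ne j k).symm.imp (eq_zero_of_mem_stdSimplex_of_apply_eq_one hb hk)
        fun h => h ▸ hk
    simp [hslope, hb.2, hg.2]
  · push Not at hone
    exact Finset.sum_nonneg fun j _ => endpointSlope_sub_nonneg hg (hone j)

theorem pos_of_sum_endpointSlope_nonpos (hb : b ∈ stdSimplex ℝ ι) (hg : g ∈ stdSimplex ℝ ι)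
    (hsum : ∑ j, endpointSlope (b j) (g j - b j) ≤ 0) (hb1 : ∀ j, b j ≠ 1) {k : ι}
    (hk : 0 < g k) : 0 < b k := by
  refine (hb.1 k).lt_of_ne' fun h0 => hsum.not_gt ?_
  exact Finset.sum_pos' (fun j _ => endpointSlope_sub_nonneg hg (hb1 j))
    ⟨k, Finset.mem_univ k, by simpa [endpointSlope, h0] using hk⟩

end Simplex

variable {n : Type*} [Fintype n] [DecidableEq n] {c p β γ : Matrix n n ℝ} {T : ℝ}

theorem exists_permMatrix_eq (hβ : β ∈ doublyStochastic ℝ n) (hone : ∀ i, ∃ j, β i j = 1) :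
    ∃ τ : Equiv.Perm n, β = τ.permMatrix ℝ := by
  choose f hf using hone
  have hinj : Function.Injective f := fun i k hik => by
    by_contra hne
    have hzero : β i (f k) = 0 := eq_zero_of_mem_stdSimplex_of_apply_eq_one
      (row_mem_stdSimplex (transpose_mem_doublyStochastic_iff.2 hβ) (f k)) (hf k) hne
    rw [← hik, hf i] at hzero
    exact one_ne_zero hzero
  refine ⟨Equiv.ofBijective f (Finite.injective_iff_bijective.1 hinj), Matrix.ext fun i j => ?_⟩
  rw [permMatrix_apply, Equiv.ofBijective_apply]
  split_ifs with hj
  · rw [hj, hf i]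
  · exact eq_zero_of_mem_stdSimplex_of_apply_eq_one (row_mem_stdSimplex hβ i) (hf i) hj

theorem sum_endpointSlope_nonpos (hT : 0 < T) (hβ : β ∈ bethePolytope p)
    (hmin : IsMinOn (betheObjective c T) (bethePolytope p) β) (hγ : γ ∈ betheInterior p) :
    ∑ i, ∑ j, endpointSlope (β i j) (γ i j - β i j) ≤ 0 := by
  by_contra! hpos
  obtain ⟨L, hL⟩ := exists_tendsto_frobeniusPairing_betheGradient_line c T β (γ - β)
  have hbot : Filter.Tendsto (fun t : ℝ =>
      frobeniusPairing (betheGradient c T (β + t • (γ - β))) (γ - β))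
      (nhdsWithin 0 (Set.Ioi 0)) Filter.atBot := by
    refine (hL.add_atBot (Real.tendsto_log_nhdsGT_zero.const_mul_atBot (mul_pos hT hpos))).congr
      fun t => ?_
    simp
  obtain ⟨δ, hδ, hneg⟩ := mem_nhdsGT_iff_exists_Ioo_subset.1
    ((hbot.eventually_lt_atBot 0).and (Ioo_mem_nhdsGT one_pos))
  obtain ⟨t, ht0, htδ⟩ := exists_between (Set.mem_Ioi.1 hδ)
  have hderiv : ∀ s ∈ Set.Ioo 0 t, HasDerivAt (fun s : ℝ => betheObjective c T (β + s • (γ - β)))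
      (frobeniusPairing (betheGradient c T (β + s • (γ - β))) (γ - β)) s := fun s hs => by
    have hmem := add_smul_sub_mem_betheInterior hγ hβ (t := 1 - s)
      ⟨by linarith [(hneg ⟨hs.1, hs.2.trans htδ⟩).2.2], by linarith [hs.1]⟩
    have heq : γ + (1 - s) • (β - γ) = β + s • (γ - β) := by module
    exact hasDerivAt_betheObjective_line c T fun i j hij =>
      (heq ▸ hmem).2 i j ((isTangent_sub hβ hγ.1).pos_of_ne_zero i j hij)
  have hcont : Continuous fun s : ℝ => betheObjective c T (β + s • (γ - β)) :=
    (continuous_betheObjective c).comp (by fun_prop : Continuous fun s : ℝ => (T, β + s • (γ - β)))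
  have hanti : StrictAntiOn (fun s : ℝ => betheObjective c T (β + s • (γ - β))) (Set.Icc 0 t) := by
    refine strictAntiOn_of_deriv_neg (convex_Icc 0 t) hcont.continuousOn fun s hs => ?_
    rw [interior_Icc] at hs
    rw [(hderiv s hs).deriv]
    exact (hneg ⟨hs.1, hs.2.trans htδ⟩).1
  have hlt := hanti (Set.left_mem_Icc.2 ht0.le) (Set.right_mem_Icc.2 ht0.le) ht0
  have hle := isMinOn_iff.1 hmin _ <| (convex_bethePolytope p).add_smul_sub_mem hβ hγ.1
    (t := t) ⟨ht0.le, (hneg ⟨ht0, htδ⟩).2.2.le⟩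
  simp only [zero_smul, add_zero] at hlt
  exact hlt.not_ge hle

theorem pos_of_forall_row_ne_one (hβ : β ∈ doublyStochastic ℝ n) (hγ : γ ∈ betheInterior p)
    (hslope : ∑ i, ∑ j, endpointSlope (β i j) (γ i j - β i j) ≤ 0) {i j : n}
    (hi : ∀ k, β i k ≠ 1) (hij : 0 < p i j) : 0 < β i j := by
  have hrow := fun i => sum_endpointSlope_nonneg (row_mem_stdSimplex hβ i)
    (row_mem_stdSimplex hγ.1.1 i)
  exact pos_of_sum_endpointSlope_nonpos (row_mem_stdSimplex hβ i) (row_mem_stdSimplex hγ.1.1 i)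
    ((Finset.single_le_sum (fun i _ => hrow i) (Finset.mem_univ i)).trans hslope) hi
    (hγ.2 i j hij).1

theorem forall_col_ne_one_of_forall_row_ne_one (hβ : β ∈ doublyStochastic ℝ n)
    (hγ : γ ∈ betheInterior p)
    (hslope : ∑ i, ∑ j, endpointSlope (β i j) (γ i j - β i j) ≤ 0) {i j : n}
    (hi : ∀ k, β i k ≠ 1) (hij : 0 < p i j) (k : n) : β k j ≠ 1 := by
  intro hk
  have hik : i ≠ k := fun h => hi j (h ▸ hk)
  exact (pos_of_forall_row_ne_one hβ hγ hslope hi hij).ne'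
    (eq_zero_of_mem_stdSimplex_of_apply_eq_one
      (row_mem_stdSimplex (transpose_mem_doublyStochastic_iff.2 hβ) j) hk hik)

end Boundary

theorem FullyIndecomposable.mem_betheInterior_or_eq_permMatrix {N : ℕ} [Nontrivial (Fin N)]
    {p c β : Matrix (Fin N) (Fin N) ℝ} (hind : FullyIndecomposable p) {T : ℝ} (hT : 0 < T)
    (hβ : β ∈ bethePolytope p) (hmin : IsMinOn (betheObjective c T) (bethePolytope p) β) :
    β ∈ betheInterior p ∨ ∃ τ : Equiv.Perm (Fin N), β = τ.permMatrix ℝ := by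
  obtain ⟨γ, hγ⟩ := hind.betheInterior_nonempty
  have hslope := sum_endpointSlope_nonpos hT hβ hmin hγ
  have hslope' :
      ∑ i, ∑ j, endpointSlope (β.transpose i j) (γ.transpose i j - β.transpose i j) ≤ 0 :=
    Finset.sum_comm.trans_le hslope
  by_cases hfrac : ∃ i, ∀ k, β i k ≠ 1
  · obtain ⟨i, hi⟩ := hfrac
    have hall := hind.forall_of_exists (P := fun i => ∀ k, β i k ≠ 1) (fun i i' j hij hij' hi =>
      forall_col_ne_one_of_forall_row_ne_one (i := j) (j := i')
        (transpose_mem_doublyStochastic_iff.2 hβ.1) (transpose_mem_betheInterior hγ) hslope'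
        (forall_col_ne_one_of_forall_row_ne_one hβ.1 hγ hslope hi hij) hij') hi
    exact .inl <| hind.mem_betheInterior_of_pos hβ fun i j hij =>
      pos_of_forall_row_ne_one hβ.1 hγ hslope (hall i) hij
  · push Not at hfrac
    exact .inr (exists_permMatrix_eq hβ.1 hfrac)

/-! ### Belief propagation -/

section BeliefPropagation

variable {N : ℕ} {p β γ v : Matrix (Fin N) (Fin N) ℝ} {T : ℝ}

/-- The cost matrix `-ln p`. An entry with `p i j = 0` gets the cost `0`, which is harmless on
`bethePolytope p`. -/
noncomputable def logCost {n : Type*} (p : Matrix n n ℝ) : Matrix n n ℝ :=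
  Matrix.of fun i j => -Real.log (p i j)

theorem thermalMatrix_eq_exp {i j : Fin N} (hij : 0 < p i j) (T : ℝ) :
    thermalMatrix p T i j = Real.exp (Real.log (p i j) / T) := by
  simp [thermalMatrix, Real.rpow_def_of_pos hij, div_eq_mul_inv]

theorem thermalMatrix_eq_zero {i j : Fin N} (hij : p i j = 0) (hT : 0 < T) :
    thermalMatrix p T i j = 0 := by
  simp [thermalMatrix, hij, Real.zero_rpow, hT.ne']

theorem isBPSolution_of_isMinOn (hp : ∀ i j, 0 ≤ p i j) (hT : 0 < T) (hβ : β ∈ betheInterior p)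
    (hmin : IsMinOn (betheObjective (logCost p) T) (bethePolytope p) β) :
    IsBPSolution p T β := by
  obtain ⟨μ, ν, h⟩ := exists_multipliers fun v => frobeniusPairing_betheGradient_eq_zero hβ hmin
  refine ⟨hβ.1.1, fun i => μ i / T - 2, fun j => ν j / T, fun i j => ?_⟩
  rcases (hp i j).eq_or_lt' with hij | hij
  · have hβij : β i j = 0 := by_contra fun h0 => (hβ.1.2 i j h0).ne' hij
    rw [thermalMatrix_eq_zero hij hT, hβij, zero_mul, zero_mul]
  · have hprod : 0 < β i j * (1 - β i j) :=
      mul_pos (hβ.2 i j hij).1 (sub_pos.2 (hβ.2 i j hij).2)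
    have hgrad := h i j hij
    simp only [betheGradient, betheEntropyGradient, logCost, Matrix.sub_apply, Matrix.smul_apply,
      Matrix.of_apply, smul_eq_mul] at hgrad
    rw [thermalMatrix_eq_exp hij, ← Real.exp_add]
    refine (Real.exp_log hprod).symm.trans (congrArg Real.exp ?_)
    field_simp
    linarith

theorem IsBPSolution.mem_betheInterior [Nontrivial (Fin N)] (h : IsBPSolution p T β)
    (hp : ∀ i j, 0 ≤ p i j) (hind : FullyIndecomposable p) (hT : 0 < T) : β ∈ betheInterior p := by
  obtain ⟨hβ, μ, ν, hbp⟩ := h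
  have hpos : ∀ i j, 0 < p i j → 0 < β i j := by
    refine fun i j hij => (nonneg_of_mem_doublyStochastic hβ).lt_of_ne fun h0 => ?_
    have hzero := hbp i j
    rw [← h0, zero_mul, thermalMatrix_eq_exp hij] at hzero
    exact (mul_pos (Real.exp_pos _) (Real.exp_pos _)).ne hzero
  refine hind.mem_betheInterior_of_pos ⟨hβ, fun i j hij => (hp i j).lt_of_ne' fun h0 => ?_⟩ hpos
  have hone := hbp i j
  rw [thermalMatrix_eq_zero h0 hT, zero_mul, mul_eq_zero, or_iff_right hij, sub_eq_zero] at hone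
  obtain ⟨k, hkj, hik⟩ := hind.exists_ne_pos i j
  exact (hpos i k hik).ne'
    (eq_zero_of_mem_stdSimplex_of_apply_eq_one (row_mem_stdSimplex hβ i) hone.symm hkj)

theorem IsBPSolution.frobeniusPairing_betheGradient_eq_zero (h : IsBPSolution p T β) (hT : 0 < T)
    (hv : IsTangent p v) : frobeniusPairing (betheGradient (logCost p) T β) v = 0 := by
  obtain ⟨-, μ, ν, hbp⟩ := h
  have hentry : ∀ i j, betheGradient (logCost p) T β i j * v i j =
      T * (μ i + 2) * v i j + T * ν j * v i j := by
    intro i j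
    by_cases hvij : v i j = 0
    · simp [hvij]
    · simp only [betheGradient, betheEntropyGradient, logCost, Matrix.sub_apply, Matrix.smul_apply,
        Matrix.of_apply, smul_eq_mul, hbp, thermalMatrix_eq_exp (hv.pos_of_ne_zero i j hvij),
        ← Real.exp_add, Real.log_exp]
      field_simp
      ring
  simp only [frobeniusPairing_apply, hentry, Finset.sum_add_distrib, ← Finset.mul_sum, hv.sum_row,
    mul_zero, zero_add]
  rw [Finset.sum_comm]
  simp only [← Finset.mul_sum, hv.sum_col, mul_zero, Finset.sum_const_zero]

theorem FullyIndecomposable.betheObjective_lt {c : Matrix (Fin N) (Fin N) ℝ}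
    (hind : FullyIndecomposable p) (hrow : ∃ i, 2 < {j | 0 < p i j}.ncard) (hT : 0 < T)
    (hβ : β ∈ betheInterior p) (hγ : γ ∈ bethePolytope p) (hne : γ ≠ β)
    (hcrit : frobeniusPairing (betheGradient c T β) (γ - β) = 0) :
    betheObjective c T β < betheObjective c T γ := by
  have hconcave := mul_lt_mul_of_pos_left
    (hind.betheEntropy_lt_add_frobeniusPairing hrow hβ hγ hne) hT
  rw [frobeniusPairing_betheGradient, map_sub] at hcrit
  simp only [betheObjective]
  linarith

theorem IsBPSolution.betheObjective_lt_permMatrix [Nontrivial (Fin N)] (h : IsBPSolution p T β)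
    (hp : ∀ i j, 0 ≤ p i j) (hind : FullyIndecomposable p)
    (hrow : ∃ i, 2 < {j | 0 < p i j}.ncard) (hT : 0 < T) {τ : Equiv.Perm (Fin N)}
    (hτ : ∀ i, 0 < p i (τ i)) :
    betheObjective (logCost p) T β < betheObjective (logCost p) T (τ.permMatrix ℝ) := by
  have hβ := h.mem_betheInterior hp hind hT
  have hτ' := permMatrix_mem_bethePolytope hτ
  exact hind.betheObjective_lt hrow hT hβ hτ'
    (fun heq => permMatrix_notMem_betheInterior τ (heq ▸ hβ))
    (h.frobeniusPairing_betheGradient_eq_zero hT (isTangent_sub hβ.1 hτ'))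

theorem betheFreeEnergy_eq_betheObjective (hT : 0 < T) (hβ : β ∈ bethePolytope p) :
    betheFreeEnergy p T β = (betheObjective (logCost p) T β : EReal) := by
  rw [betheFreeEnergy, if_neg fun ⟨i, j, hij, h⟩ => (hβ.2 i j h).ne' hij]
  congr 1
  simp only [betheObjective, frobeniusPairing_apply, betheEntropy, Finset.mul_sum,
    ← Finset.sum_sub_distrib, betheEntropyTerm, Real.negMulLog, logCost, Matrix.of_apply]
  refine Finset.sum_congr rfl fun i _ => Finset.sum_congr rfl fun j _ => ?_
  by_cases h : β i j = 0
  · simp [h]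
  · have hij := hβ.2 i j h
    rw [thermalMatrix_eq_exp hij, Real.log_div h (Real.exp_pos _).ne', Real.log_exp]
    field_simp
    ring

theorem isMinOn_betheFreeEnergy (hp : ∀ i j, 0 ≤ p i j) (hT : 0 < T) (hβ : β ∈ bethePolytope p)
    (hmin : IsMinOn (betheObjective (logCost p) T) (bethePolytope p) β) :
    IsMinOn (betheFreeEnergy p T)
      (doublyStochastic ℝ (Fin N) : Set (Matrix (Fin N) (Fin N) ℝ)) β := by
  refine isMinOn_iff.2 fun γ hγ => ?_
  by_cases hγ' : γ ∈ bethePolytope p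
  · rw [betheFreeEnergy_eq_betheObjective hT hβ, betheFreeEnergy_eq_betheObjective hT hγ']
    exact EReal.coe_le_coe_iff.2 (isMinOn_iff.1 hmin γ hγ')
  · have hoff : ∃ i j, p i j = 0 ∧ γ i j ≠ 0 := by
      by_contra! h
      exact hγ' ⟨hγ, fun i j hij => (hp i j).lt_of_ne' fun h0 => hij (h i j h0)⟩
    have htop : betheFreeEnergy p T γ = ⊤ := if_pos hoff
    exact le_top.trans_eq htop.symm

end BeliefPropagation

/-! ### The maximum-likelihood matching -/

section Vertices

variable {n : Type*} [Fintype n] [DecidableEq n] {c p : Matrix n n ℝ} {σ : Equiv.Perm n}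

theorem isMinOn_frobeniusPairing_permMatrix
    (hle : ∀ τ : Equiv.Perm n, (∀ i, 0 < p i (τ i)) →
      frobeniusPairing c (σ.permMatrix ℝ) ≤ frobeniusPairing c (τ.permMatrix ℝ)) :
    IsMinOn (frobeniusPairing c) (bethePolytope p) (σ.permMatrix ℝ) := by
  rw [bethePolytope_eq_convexHull]
  refine convexHull_min ?_ (convex_halfSpace_ge (frobeniusPairing c).isLinear _)
  rintro _ ⟨τ, hτ, rfl⟩
  exact hle τ hτ

theorem eventually_isMinOn_frobeniusPairing_add_smul
    (hlt : ∀ τ : Equiv.Perm n, (∀ i, 0 < p i (τ i)) → τ ≠ σ →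
      frobeniusPairing c (σ.permMatrix ℝ) < frobeniusPairing c (τ.permMatrix ℝ))
    (d : Matrix n n ℝ) :
    ∀ᶠ k in nhds (0 : ℝ),
      IsMinOn (frobeniusPairing (c + k • d)) (bethePolytope p) (σ.permMatrix ℝ) := by
  have hcont : ∀ τ : Equiv.Perm n,
      Continuous fun k : ℝ => frobeniusPairing (c + k • d) (τ.permMatrix ℝ) := fun τ => by
    simp only [frobeniusPairing_permMatrix, Matrix.add_apply, Matrix.smul_apply]
    fun_prop
  have hvertex : ∀ᶠ k in nhds (0 : ℝ), ∀ τ : Equiv.Perm n, (∀ i, 0 < p i (τ i)) →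
      frobeniusPairing (c + k • d) (σ.permMatrix ℝ) ≤
        frobeniusPairing (c + k • d) (τ.permMatrix ℝ) := by
    refine Filter.eventually_all.2 fun τ => ?_
    rcases eq_or_ne τ σ with rfl | hne
    · exact Filter.Eventually.of_forall fun _ _ => le_rfl
    by_cases hτ : ∀ i, 0 < p i (τ i)
    · filter_upwards [(hcont σ).continuousAt.eventually_lt (hcont τ).continuousAt
        (by simpa using hlt τ hτ hne)] with k hk _ using hk.le
    · exact Filter.Eventually.of_forall fun _ h => absurd h hτ
  exact hvertex.mono fun k => isMinOn_frobeniusPairing_permMatrix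

theorem betheEntropy_le_card_mul_sub {β : Matrix n n ℝ} (hβ : β ∈ doublyStochastic ℝ n)
    (σ : Equiv.Perm n) : betheEntropy β ≤
      Fintype.card n * (Fintype.card n - frobeniusPairing (σ.permMatrix ℝ) β) := by
  refine (Finset.sum_le_sum fun i _ =>
    sum_betheEntropyTerm_le (row_mem_stdSimplex hβ i) (σ i)).trans_eq ?_
  simp [frobeniusPairing_apply, ← Finset.mul_sum, Finset.sum_sub_distrib]

theorem exists_pos_isMinOn_betheObjective_permMatrix [Nonempty n]
    (hlt : ∀ τ : Equiv.Perm n, (∀ i, 0 < p i (τ i)) → τ ≠ σ →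
      frobeniusPairing c (σ.permMatrix ℝ) < frobeniusPairing c (τ.permMatrix ℝ)) :
    ∃ T > 0, IsMinOn (betheObjective c T) (bethePolytope p) (σ.permMatrix ℝ) := by
  obtain ⟨k, hk, hmin⟩ := ((eventually_isMinOn_frobeniusPairing_add_smul hlt
    (σ.permMatrix ℝ)).filter_mono nhdsWithin_le_nhds |>.and
      (self_mem_nhdsWithin (s := Set.Ioi 0))).exists.imp fun _ h => h.symm
  have hcard : (0 : ℝ) < Fintype.card n := Nat.cast_pos.2 Fintype.card_pos
  refine ⟨k / Fintype.card n, div_pos hk hcard, isMinOn_iff.2 fun β hβ => ?_⟩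
  have hentropy := mul_le_mul_of_nonneg_left (betheEntropy_le_card_mul_sub hβ.1 σ)
    (div_pos hk hcard).le
  rw [← mul_assoc, div_mul_cancel₀ _ hcard.ne'] at hentropy
  have hadd : ∀ γ, frobeniusPairing (c + k • σ.permMatrix ℝ) γ =
      frobeniusPairing c γ + k * frobeniusPairing (σ.permMatrix ℝ) γ := fun γ => by
    simp only [frobeniusPairing_apply, Matrix.add_apply, Matrix.smul_apply, smul_eq_mul, add_mul,
      Finset.sum_add_distrib, Finset.mul_sum, mul_assoc]
  have hself : frobeniusPairing (σ.permMatrix ℝ) (σ.permMatrix ℝ) = Fintype.card n := by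
    simp [frobeniusPairing_permMatrix]
  have hle := isMinOn_iff.1 hmin β hβ
  rw [hadd, hadd, hself] at hle
  rw [betheObjective_permMatrix, betheObjective]
  linarith

end Vertices

section MLMatching

variable {N : ℕ} {p β γ : Matrix (Fin N) (Fin N) ℝ} {σ τ : Equiv.Perm (Fin N)} {T : ℝ}

theorem IsMLMatching.pos [Nontrivial (Fin N)] (hσ : IsMLMatching p σ) (hp : ∀ i j, 0 ≤ p i j)
    (i : Fin N) : 0 < p i (σ i) := by
  obtain ⟨τ, hτ⟩ := exists_ne σ
  have hprod := (Finset.prod_nonneg fun i _ => hp i (τ i)).trans_lt (hσ τ hτ)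
  exact (hp i (σ i)).lt_of_ne' (Finset.prod_ne_zero_iff.1 hprod.ne' i (Finset.mem_univ i))

theorem IsMLMatching.frobeniusPairing_logCost_lt (hσ : IsMLMatching p σ)
    (hτ : ∀ i, 0 < p i (τ i)) (hne : τ ≠ σ) :
    frobeniusPairing (logCost p) (σ.permMatrix ℝ) <
      frobeniusPairing (logCost p) (τ.permMatrix ℝ) := by
  have hlt := hσ τ hne
  have hτ0 : 0 < ∏ i, p i (τ i) := Finset.prod_pos fun i _ => hτ i
  have hσ0 : ∀ i ∈ Finset.univ, p i (σ i) ≠ 0 := Finset.prod_ne_zero_iff.1 (hτ0.trans hlt).ne'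
  simp only [frobeniusPairing_permMatrix, logCost, Matrix.of_apply, Finset.sum_neg_distrib]
  rw [← Real.log_prod fun i _ => (hτ i).ne', ← Real.log_prod hσ0]
  exact neg_lt_neg (Real.log_lt_log hτ0 hlt)

theorem IsMLMatching.mem_betheInterior_or_eq_permMatrix [Nontrivial (Fin N)]
    (hσ : IsMLMatching p σ) (hp : ∀ i j, 0 ≤ p i j) (hind : FullyIndecomposable p) (hT : 0 < T)
    (hβ : β ∈ bethePolytope p)
    (hmin : IsMinOn (betheObjective (logCost p) T) (bethePolytope p) β) :
    β ∈ betheInterior p ∨ β = σ.permMatrix ℝ := by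
  refine (hind.mem_betheInterior_or_eq_permMatrix hT hβ hmin).imp_right ?_
  rintro ⟨τ, rfl⟩
  by_contra hne
  have hle := isMinOn_iff.1 hmin _ (permMatrix_mem_bethePolytope (hσ.pos hp))
  rw [betheObjective_permMatrix, betheObjective_permMatrix] at hle
  exact hle.not_gt <| hσ.frobeniusPairing_logCost_lt (pos_of_permMatrix_mem_bethePolytope hβ)
    fun h => hne (h ▸ rfl)

theorem eq_of_isMinOn_of_mem_betheInterior {c : Matrix (Fin N) (Fin N) ℝ}
    (hind : FullyIndecomposable p) (hrow : ∃ i, 2 < {j | 0 < p i j}.ncard) (hT : 0 < T)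
    (hβ : β ∈ betheInterior p) (hβmin : IsMinOn (betheObjective c T) (bethePolytope p) β)
    (hγ : γ ∈ bethePolytope p) (hγmin : IsMinOn (betheObjective c T) (bethePolytope p) γ) :
    γ = β := by
  by_contra hne
  exact (isMinOn_iff.1 hγmin β hβ.1).not_gt <| hind.betheObjective_lt hrow hT hβ hγ hne <|
    frobeniusPairing_betheGradient_eq_zero hβ hβmin (isTangent_sub hβ.1 hγ)

theorem IsMLMatching.eq_of_isMinOn [Nontrivial (Fin N)] (hσ : IsMLMatching p σ)
    (hp : ∀ i j, 0 ≤ p i j) (hind : FullyIndecomposable p)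
    (hrow : ∃ i, 2 < {j | 0 < p i j}.ncard) (hT : 0 < T)
    (hβ : β ∈ bethePolytope p)
    (hβmin : IsMinOn (betheObjective (logCost p) T) (bethePolytope p) β)
    (hγ : γ ∈ bethePolytope p)
    (hγmin : IsMinOn (betheObjective (logCost p) T) (bethePolytope p) γ) : γ = β := by
  rcases hσ.mem_betheInterior_or_eq_permMatrix hp hind hT hβ hβmin with hβ' | hβσ
  · exact eq_of_isMinOn_of_mem_betheInterior hind hrow hT hβ' hβmin hγ hγmin
  rcases hσ.mem_betheInterior_or_eq_permMatrix hp hind hT hγ hγmin with hγ' | hγσ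
  · exact (eq_of_isMinOn_of_mem_betheInterior hind hrow hT hγ' hγmin hβ hβmin).symm
  · rw [hγσ, hβσ]

end MLMatching

/-! ### The critical temperature -/

theorem continuousAt_of_unique_isMinOn {X Y α : Type*} [TopologicalSpace X] [TopologicalSpace Y]
    [LinearOrder α] [TopologicalSpace α] [OrderClosedTopology α] {f : X × Y → α} (hf : Continuous f)
    {K : Set Y} (hK : IsCompact K) {m : X → Y} (hm : ∀ x, m x ∈ K)
    (hmin : ∀ x, IsMinOn (fun y => f (x, y)) K (m x)) {x₀ : X}
    (huniq : ∀ y ∈ K, IsMinOn (fun y => f (x₀, y)) K y → y = m x₀) : ContinuousAt m x₀ := by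
  refine hK.tendsto_nhds_of_unique_mapClusterPt (Filter.Eventually.of_forall hm) fun y hy hclus =>
    huniq y hy (isMinOn_iff.2 fun z hz => ?_)
  obtain ⟨U, hU, hUy⟩ := mapClusterPt_iff_ultrafilter.1 hclus
  exact le_of_tendsto_of_tendsto'
    ((hf.tendsto (x₀, y)).comp (Filter.Tendsto.prodMk_nhds (Filter.tendsto_id.mono_left hU) hUy))
    ((hf.tendsto (x₀, z)).comp
      (Filter.Tendsto.prodMk_nhds (Filter.tendsto_id.mono_left hU) tendsto_const_nhds))
    fun x => isMinOn_iff.1 (hmin x) z hz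

section CriticalTemperature

variable {N : ℕ} {p β : Matrix (Fin N) (Fin N) ℝ} {σ : Equiv.Perm (Fin N)} {T : ℝ}

/-- The largest temperature at which the matching `σ` minimizes the Bethe free energy. -/
noncomputable def criticalTemperature {n : Type*} [Fintype n] [DecidableEq n] (p : Matrix n n ℝ)
    (σ : Equiv.Perm n) : ℝ :=
  sSup {T | IsMinOn (betheObjective (logCost p) T) (bethePolytope p) (σ.permMatrix ℝ)}

theorem isClosed_setOf_isMinOn_betheObjective {n : Type*} [Fintype n] (c : Matrix n n ℝ)
    (K : Set (Matrix n n ℝ)) (β : Matrix n n ℝ) :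
    IsClosed {T | IsMinOn (betheObjective c T) K β} := by
  have hcont : ∀ γ, Continuous fun T => betheObjective c T γ := fun γ =>
    (continuous_betheObjective c).comp (continuous_id.prodMk continuous_const)
  simp only [isMinOn_iff, Set.ofPred_forall]
  exact isClosed_biInter fun γ _ => isClosed_le (hcont β) (hcont γ)

theorem FullyIndecomposable.bddAbove_setOf_isMinOn [Nontrivial (Fin N)]
    (hind : FullyIndecomposable p) (hrow : ∃ i, 2 < {j | 0 < p i j}.ncard)
    (c : Matrix (Fin N) (Fin N) ℝ) (σ : Equiv.Perm (Fin N)) :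
    BddAbove {T | IsMinOn (betheObjective c T) (bethePolytope p) (σ.permMatrix ℝ)} := by
  obtain ⟨γ, hγ⟩ := hind.betheInterior_nonempty
  refine ⟨(frobeniusPairing c γ - frobeniusPairing c (σ.permMatrix ℝ)) / betheEntropy γ,
    fun T hT => (le_div_iff₀ (hind.betheEntropy_pos hrow hγ)).2 ?_⟩
  have hle := isMinOn_iff.1 hT γ hγ.1
  rw [betheObjective_permMatrix, betheObjective] at hle
  linarith

theorem IsMLMatching.criticalTemperature_pos [Nontrivial (Fin N)] (hσ : IsMLMatching p σ)
    (hind : FullyIndecomposable p) (hrow : ∃ i, 2 < {j | 0 < p i j}.ncard) :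
    0 < criticalTemperature p σ := by
  obtain ⟨T, hT, hmin⟩ := exists_pos_isMinOn_betheObjective_permMatrix
    fun τ => hσ.frobeniusPairing_logCost_lt (τ := τ)
  exact hT.trans_le (le_csSup (hind.bddAbove_setOf_isMinOn hrow (logCost p) σ) hmin)

theorem IsMLMatching.isMinOn_criticalTemperature [Nontrivial (Fin N)] (hσ : IsMLMatching p σ)
    (hind : FullyIndecomposable p) (hrow : ∃ i, 2 < {j | 0 < p i j}.ncard) :
    IsMinOn (betheObjective (logCost p) (criticalTemperature p σ)) (bethePolytope p)
      (σ.permMatrix ℝ) := by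
  obtain ⟨T, -, hmin⟩ := exists_pos_isMinOn_betheObjective_permMatrix
    fun τ => hσ.frobeniusPairing_logCost_lt (τ := τ)
  exact (isClosed_setOf_isMinOn_betheObjective _ _ _).csSup_mem ⟨T, hmin⟩
    (hind.bddAbove_setOf_isMinOn hrow (logCost p) σ)

theorem IsMLMatching.mem_betheInterior_of_criticalTemperature_lt [Nontrivial (Fin N)]
    (hσ : IsMLMatching p σ) (hp : ∀ i j, 0 ≤ p i j) (hind : FullyIndecomposable p)
    (hrow : ∃ i, 2 < {j | 0 < p i j}.ncard) (hT : criticalTemperature p σ < T)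
    (hβ : β ∈ bethePolytope p)
    (hmin : IsMinOn (betheObjective (logCost p) T) (bethePolytope p) β) :
    β ∈ betheInterior p := by
  refine (hσ.mem_betheInterior_or_eq_permMatrix hp hind
    ((hσ.criticalTemperature_pos hind hrow).trans hT) hβ hmin).resolve_right ?_
  rintro rfl
  exact (le_csSup (hind.bddAbove_setOf_isMinOn hrow (logCost p) σ) hmin).not_gt hT

theorem IsMLMatching.not_isBPSolution_of_lt_criticalTemperature [Nontrivial (Fin N)]
    (hσ : IsMLMatching p σ) (hp : ∀ i j, 0 ≤ p i j) (hind : FullyIndecomposable p)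
    (hrow : ∃ i, 2 < {j | 0 < p i j}.ncard) (hT : 0 < T) (hTc : T < criticalTemperature p σ) :
    ¬ IsBPSolution p T β := by
  intro h
  have hβ := h.mem_betheInterior hp hind hT
  have hlt := h.betheObjective_lt_permMatrix hp hind hrow hT (hσ.pos hp)
  have hle := isMinOn_iff.1 (hσ.isMinOn_criticalTemperature hind hrow) β hβ.1
  have hcool := mul_lt_mul_of_pos_right hTc (hind.betheEntropy_pos hrow hβ)
  rw [betheObjective_permMatrix, betheObjective] at hlt hle
  linarith

end CriticalTemperature

/-! ### The critical determinant -/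

section RowRatio

variable {ι : Type*} [Fintype ι] {b : ι → ℝ} {k : ι}

/-- For a probability vector `b`, the ratio of the total variance `∑ j, b j * (1 - b j)` to its
`k`-th term. It replaces the factor `2` of the critical matrix at a belief-propagation solution. It
is `0 / 0` at the vertex `k` of the simplex, where its limit is `2`. -/
noncomputable def varianceRatio (b : ι → ℝ) (k : ι) : ℝ :=
  (∑ j, b j * (1 - b j)) / (b k * (1 - b k))

theorem two_le_varianceRatio (hb : b ∈ stdSimplex ℝ ι) (h0 : 0 < b k) (h1 : b k < 1) :
    2 ≤ varianceRatio b k := by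
  classical
  have herase : ∑ j ∈ Finset.univ.erase k, b j = 1 - b k := by
    rw [Finset.sum_erase_eq_sub (Finset.mem_univ k), hb.2]
  have hothers : b k * (1 - b k) ≤ ∑ j ∈ Finset.univ.erase k, b j * (1 - b j) := by
    rw [mul_comm, ← herase, Finset.sum_mul]
    refine Finset.sum_le_sum fun j hj => mul_le_mul_of_nonneg_left ?_ (hb.1 j)
    have : b j ≤ 1 - b k := herase ▸ Finset.single_le_sum (fun i _ => hb.1 i) hj
    linarith
  rw [varianceRatio, le_div_iff₀ (mul_pos h0 (sub_pos.2 h1)),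
    ← Finset.add_sum_erase _ _ (Finset.mem_univ k)]
  linarith

theorem varianceRatio_le (hb : b ∈ stdSimplex ℝ ι) (h0 : 0 < b k) (h1 : b k < 1) :
    varianceRatio b k ≤ 1 + 1 / b k := by
  classical
  have hothers : ∑ j ∈ Finset.univ.erase k, b j * (1 - b j) ≤ 1 - b k :=
    calc ∑ j ∈ Finset.univ.erase k, b j * (1 - b j)
        ≤ ∑ j ∈ Finset.univ.erase k, b j := Finset.sum_le_sum fun j _ =>
          mul_le_of_le_one_right (hb.1 j) (sub_le_self _ (hb.1 j))
      _ = 1 - b k := by rw [Finset.sum_erase_eq_sub (Finset.mem_univ k), hb.2]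
  have hk : 0 < 1 - b k := sub_pos.2 h1
  rw [varianceRatio, div_le_iff₀ (mul_pos h0 hk), ← Finset.add_sum_erase _ _ (Finset.mem_univ k)]
  refine (add_le_add_right hothers _).trans_eq ?_
  field_simp

theorem tendsto_varianceRatio {α : Type*} {l : Filter α} {u : α → ι → ℝ}
    (hu : ∀ᶠ x in l, u x ∈ stdSimplex ℝ ι ∧ 0 < u x k ∧ u x k < 1)
    (hlim : Filter.Tendsto (fun x => u x k) l (nhds 1)) :
    Filter.Tendsto (fun x => varianceRatio (u x) k) l (nhds 2) := by
  have hupper : Filter.Tendsto (fun x => 1 + 1 / u x k) l (nhds 2) := by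
    simpa only [one_div, inv_one, one_add_one_eq_two] using (hlim.inv₀ one_ne_zero).const_add 1
  refine tendsto_of_tendsto_of_tendsto_of_le_of_le' tendsto_const_nhds hupper ?_ ?_
  · exact hu.mono fun x hx => two_le_varianceRatio hx.1 hx.2.1 hx.2.2
  · exact hu.mono fun x hx => varianceRatio_le hx.1 hx.2.1 hx.2.2

end RowRatio

section Determinant

variable {N : ℕ} {p β : Matrix (Fin N) (Fin N) ℝ} {σ : Equiv.Perm (Fin N)} {T : ℝ}

theorem continuousAt_thermalMatrix (p : Matrix (Fin N) (Fin N) ℝ) (hT : 0 < T) :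
    ContinuousAt (thermalMatrix p) T :=
  continuousAt_pi.2 fun _ => continuousAt_pi.2 fun _ => continuousAt_const.rpow
    (continuousAt_const.div continuousAt_id hT.ne') (Or.inr (one_div_pos.2 hT))

/-- The matrix `P i j - r i σ i j P i j`, which is `criticalMatrix p σ T` when `r` is constantly
`2`. -/
noncomputable def tiltedMatrix (p : Matrix (Fin N) (Fin N) ℝ) (σ : Equiv.Perm (Fin N)) (T : ℝ)
    (r : Fin N → ℝ) : Matrix (Fin N) (Fin N) ℝ :=
  Matrix.of fun i j => thermalMatrix p T i j - r i * σ.permMatrix ℝ i j * thermalMatrix p T i j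

theorem IsBPSolution.det_tiltedMatrix_eq_zero [Nonempty (Fin N)] (h : IsBPSolution p T β)
    (hσ : ∀ i, 0 < β i (σ i) ∧ β i (σ i) < 1) :
    (tiltedMatrix p σ T fun i => varianceRatio (β i) (σ i)).det = 0 := by
  obtain ⟨-, μ, ν, hbp⟩ := h
  refine Matrix.exists_mulVec_eq_zero_iff.1 ⟨fun j => Real.exp (ν j), fun h0 =>
    (Real.exp_pos _).ne' (congrFun h0 (Classical.arbitrary _)), funext fun i => ?_⟩
  have hentry : ∀ j, thermalMatrix p T i j * Real.exp (ν j) =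
      Real.exp (-μ i) * (β i j * (1 - β i j)) := fun j => by
    rw [hbp, Real.exp_add, Real.exp_neg]
    field_simp
  have hratio : varianceRatio (β i) (σ i) * (β i (σ i) * (1 - β i (σ i))) =
      ∑ j, β i j * (1 - β i j) :=
    div_mul_cancel₀ _ (mul_pos (hσ i).1 (sub_pos.2 (hσ i).2)).ne'
  calc ∑ j, tiltedMatrix p σ T (fun i => varianceRatio (β i) (σ i)) i j * Real.exp (ν j)
      = ∑ j, Real.exp (-μ i) * (β i j * (1 - β i j) - varianceRatio (β i) (σ i) *
          if j = σ i then β i j * (1 - β i j) else 0) :=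
        Finset.sum_congr rfl fun j _ => by
          rw [tiltedMatrix, Matrix.of_apply, permMatrix_apply, sub_mul,
            mul_assoc _ (thermalMatrix _ _ _ _), hentry]
          split_ifs <;> ring
    _ = 0 := by
        rw [← Finset.mul_sum, Finset.sum_sub_distrib, ← Finset.mul_sum,
          Finset.sum_ite_eq', if_pos (Finset.mem_univ _), hratio, sub_self, mul_zero]

theorem det_criticalMatrix_eq_zero_of_tendsto [Nonempty (Fin N)] (hσ : ∀ i, 0 < p i (σ i))
    (hT : 0 < T) {m : ℝ → Matrix (Fin N) (Fin N) ℝ}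
    (hm : Filter.Tendsto m (nhdsWithin T (Set.Ioi T)) (nhds (σ.permMatrix ℝ)))
    (hfrac : ∀ S > T, m S ∈ betheInterior p) (hbp : ∀ S > T, IsBPSolution p S (m S)) :
    (criticalMatrix p σ T).det = 0 := by
  have hratio : ∀ i, Filter.Tendsto (fun S => varianceRatio (m S i) (σ i))
      (nhdsWithin T (Set.Ioi T)) (nhds 2) := fun i => by
    refine tendsto_varianceRatio (Filter.eventually_of_mem self_mem_nhdsWithin fun S hS =>
      ⟨row_mem_stdSimplex (hfrac S hS).1.1 i, (hfrac S hS).2 i _ (hσ i)⟩) ?_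
    simpa [permMatrix_apply] using tendsto_pi_nhds.1 (tendsto_pi_nhds.1 hm i) (σ i)
  have hP := (continuousAt_thermalMatrix p hT).tendsto.mono_left
    (nhdsWithin_le_nhds (s := Set.Ioi T))
  have hmatrix : Filter.Tendsto
      (fun S => tiltedMatrix p σ S fun i => varianceRatio (m S i) (σ i))
      (nhdsWithin T (Set.Ioi T)) (nhds (criticalMatrix p σ T)) := by
    refine tendsto_pi_nhds.2 fun i => tendsto_pi_nhds.2 fun j => ?_
    have hPij := tendsto_pi_nhds.1 (tendsto_pi_nhds.1 hP i) j
    exact hPij.sub (((hratio i).mul_const _).mul hPij)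
  refine tendsto_nhds_unique ((continuous_id.matrix_det.tendsto _).comp hmatrix)
    (tendsto_const_nhds.congr' ?_)
  exact Filter.eventually_of_mem self_mem_nhdsWithin fun S hS =>
    ((hbp S hS).det_tiltedMatrix_eq_zero fun i => (hfrac S hS).2 i _ (hσ i)).symm

end Determinant

section Minimizers

variable {N : ℕ} {p β : Matrix (Fin N) (Fin N) ℝ} {σ : Equiv.Perm (Fin N)} {T : ℝ}

theorem nontrivial_of_lt_ncard_row (hrow : ∃ i, 2 < {j | 0 < p i j}.ncard) :
    Nontrivial (Fin N) := by
  obtain ⟨i, hi⟩ := hrow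
  obtain ⟨j, k, -, -, -, -, hjk, -⟩ := (Set.two_lt_ncard_iff (Set.toFinite _)).1 hi
  exact ⟨j, k, hjk⟩

theorem exists_isMinOn_betheObjective {n : Type*} [Fintype n] [DecidableEq n] {p : Matrix n n ℝ}
    (hne : (bethePolytope p).Nonempty) (c : Matrix n n ℝ) (T : ℝ) :
    ∃ β ∈ bethePolytope p, IsMinOn (betheObjective c T) (bethePolytope p) β :=
  (isCompact_bethePolytope p).exists_isMinOn hne
    ((continuous_betheObjective c).comp (continuous_const.prodMk continuous_id)).continuousOn

theorem IsMLMatching.exists_continuousAt_isMinOn [Nontrivial (Fin N)] (hσ : IsMLMatching p σ)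
    (hp : ∀ i j, 0 ≤ p i j) (hind : FullyIndecomposable p)
    (hrow : ∃ i, 2 < {j | 0 < p i j}.ncard) :
    ∃ m : ℝ → Matrix (Fin N) (Fin N) ℝ, (∀ T, m T ∈ bethePolytope p) ∧
      (∀ T, IsMinOn (betheObjective (logCost p) T) (bethePolytope p) (m T)) ∧
      (∀ T > 0, ContinuousAt m T) ∧ m (criticalTemperature p σ) = σ.permMatrix ℝ := by
  have hvertex := permMatrix_mem_bethePolytope (hσ.pos hp)
  choose m hm hmin using exists_isMinOn_betheObjective ⟨_, hvertex⟩ (logCost p)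
  refine ⟨m, hm, hmin, fun T hT => ?_, ?_⟩
  · exact continuousAt_of_unique_isMinOn (continuous_betheObjective (logCost p))
      (isCompact_bethePolytope p) hm hmin fun β hβ hβmin =>
        hσ.eq_of_isMinOn hp hind hrow hT (hm T) (hmin T) hβ hβmin
  · exact hσ.eq_of_isMinOn hp hind hrow (hσ.criticalTemperature_pos hind hrow) hvertex
      (hσ.isMinOn_criticalTemperature hind hrow) (hm _) (hmin _)

theorem IsBPSolution.betheFreeEnergy_lt_permMatrix [Nontrivial (Fin N)] (h : IsBPSolution p T β)
    (hp : ∀ i j, 0 ≤ p i j) (hind : FullyIndecomposable p)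
    (hrow : ∃ i, 2 < {j | 0 < p i j}.ncard) (hT : 0 < T) (hσ : ∀ i, 0 < p i (σ i)) :
    betheFreeEnergy p T β < betheFreeEnergy p T (σ.permMatrix ℝ) := by
  rw [betheFreeEnergy_eq_betheObjective hT (h.mem_betheInterior hp hind hT).1,
    betheFreeEnergy_eq_betheObjective hT (permMatrix_mem_bethePolytope hσ), EReal.coe_lt_coe_iff]
  exact h.betheObjective_lt_permMatrix hp hind hrow hT hσ

end Minimizers

theorem proposition1 (N : ℕ) (p : Matrix (Fin N) (Fin N) ℝ) (hp : ∀ i j, 0 ≤ p i j)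
    (hind : FullyIndecomposable p)
    (hcard : 2 * N < {e : Fin N × Fin N | 0 < p e.1 e.2}.ncard)
    (σ : Equiv.Perm (Fin N)) (hσ : IsMLMatching p σ) :
    ∃ Tc : ℝ, 0 < Tc ∧ (criticalMatrix p σ Tc).det = 0 ∧
      (∃ ε : ℝ, 0 < ε ∧ ∃ β : ℝ → Matrix (Fin N) (Fin N) ℝ,
        ContinuousOn β (Set.Ico Tc (Tc + ε)) ∧ β Tc = σ.permMatrix ℝ ∧
        ∀ T ∈ Set.Ioo Tc (Tc + ε),
          IsBPSolution p T (β T) ∧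
          (∀ i j, 0 < p i j → 0 < β T i j ∧ β T i j < 1) ∧
          IsLocalMinOn (betheFreeEnergy p T)
            (doublyStochastic ℝ (Fin N) : Set (Matrix (Fin N) (Fin N) ℝ)) (β T) ∧
          betheFreeEnergy p T (β T) < betheFreeEnergy p T (σ.permMatrix ℝ)) ∧
      ∀ T : ℝ, 0 < T → T < Tc →
        ¬ ∃ β : Matrix (Fin N) (Fin N) ℝ, IsBPSolution p T β ∧ ∃ i j, 0 < β i j ∧ β i j < 1 := by
  have hrow : ∃ i, 2 < {j | 0 < p i j}.ncard :=
    exists_lt_ncard_row (by rwa [Fintype.card_fin, mul_comm])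
  have := nontrivial_of_lt_ncard_row hrow
  have hTc := hσ.criticalTemperature_pos hind hrow
  obtain ⟨m, hm, hmin, hcont, hmσ⟩ := hσ.exists_continuousAt_isMinOn hp hind hrow
  have hfrac : ∀ T > criticalTemperature p σ, m T ∈ betheInterior p := fun T hT =>
    hσ.mem_betheInterior_of_criticalTemperature_lt hp hind hrow hT (hm T) (hmin T)
  have hbp : ∀ T > criticalTemperature p σ, IsBPSolution p T (m T) := fun T hT =>
    isBPSolution_of_isMinOn hp (hTc.trans hT) (hfrac T hT) (hmin T)
  refine ⟨criticalTemperature p σ, hTc, ?_, ⟨1, one_pos, m, ?_, hmσ, fun T hT => ?_⟩, ?_⟩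
  · exact det_criticalMatrix_eq_zero_of_tendsto (hσ.pos hp) hTc
      (hmσ ▸ (hcont _ hTc).mono_left nhdsWithin_le_nhds) hfrac hbp
  · exact fun T hT => (hcont T (hTc.trans_le hT.1)).continuousWithinAt
  · have hT0 := hTc.trans hT.1
    exact ⟨hbp T hT.1, (hfrac T hT.1).2, (isMinOn_betheFreeEnergy hp hT0 (hm T) (hmin T)).localize,
      (hbp T hT.1).betheFreeEnergy_lt_permMatrix hp hind hrow hT0 (hσ.pos hp)⟩
  · rintro T hT hTlt ⟨β, hβ, -⟩
    exact hσ.not_isBPSolution_of_lt_criticalTemperature hp hind hrow hT hTlt hβ
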